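/- Graphs are finite and undirected and may have loops and parallel edges; all surfaces are closed and orientable. The (minimum) genus $\gamma(X)$ of a graph $X$ is the least $k$ such that $X$ embeds in the orientable surface $S_k$ of genus $k$; in terms of cellular embeddings, it is the minimum of $\frac12\,(2c - |V| + |E| - |F|)$ over all rotation systems of $X$ (choices of a cyclic order of the edge-ends at each vertex), where $c$ is the number of components of $X$ and $|F|$ is the number of faces, counted with one face for each isolated vertex. Let $H_3$ be the graph formed from $K_{2,3}$ by attaching a pendant vertex, called a free node, to each of its three $2$-valent vertices. Let $G$ be a graph, and let $t=\{u,v,w\}$ be a triple of distinct $2$-valent vertices of $G$ that lie in one component of $G$ (for example, let $G$ be connected). Let $T_1=\{t\}$. Let $H(G,T_1)$ be the graph formed from the disjoint union of $G$ and $H_3$ by identifying the three free nodes of $H_3$, one-to-one, with $u,v,w$. Let $S(G,T_1)=\{G+uv,\ G+uw,\ G+vw\}$ be the set of the three graphs formed by adding to $G$ one new edge between two points of the triple, and let $$\gamma_{T_1}(G)=\min_{X\in S(G,T_1)}\gamma(X).$$ Then $$\gamma(H(G,T_1)) = \gamma_{T_1}(G)+1 .$$ -/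

import Mathlib

open scoped Graph

/-! Graphs are Mathlib's multigraphs `Graph α β` (loops and parallel edges allowed). -/

namespace Graph

/-- The valence of `v`: the number of edge-ends at `v`, so that a loop counts twice. -/
noncomputable def valence {α β : Type*} (G : Graph α β) (v : α) : ℕ :=
  (G.incidenceSet v).ncard + (G.loopSet v).ncard

/-- There is a walk in `G` from `u` to `v`, that is, `u` and `v` lie in the same component. -/
def Reachable {α β : Type*} (G : Graph α β) (u v : α) : Prop :=
  Relation.ReflTransGen G.Adj u v

/-- The number of connected components of `G`. -/
noncomputable def numComponents {α β : Type*} (G : Graph α β) : ℕ :=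
  Nat.card (Quot fun x y : V(G) => G.Adj x y)

/-- The number of vertices of `G` that are incident with no edge. -/
noncomputable def numIsolated {α β : Type*} (G : Graph α β) : ℕ :=
  {v | v ∈ V(G) ∧ ∀ e, ¬ G.Inc e v}.ncard

/-- A rotation system of `G`: by the Edmonds-Heffter correspondence, a cellular embedding of
(every component of) `G` in closed oriented surfaces, up to equivalence.

Each edge `e` has two ends, `(e, false)` and `(e, true)`; `vertexAt` says at which vertices they
lie (which of the two is called `false` is irrelevant). The permutation `rot` of the edge-ends
has as its cycles exactly the sets of edge-ends lying at one vertex: it is a choice of a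
cyclic ordering of the edge-ends at every vertex. -/
structure RotationSystem {α β : Type*} (G : Graph α β) where
  vertexAt : E(G) × Bool → α
  isLink_vertexAt : ∀ e : E(G), G.IsLink e (vertexAt (e, false)) (vertexAt (e, true))
  rot : Equiv.Perm (E(G) × Bool)
  sameCycle_rot_iff : ∀ d d' : E(G) × Bool, rot.SameCycle d d' ↔ vertexAt d = vertexAt d'

namespace RotationSystem

/-- The involution that interchanges the two ends of every edge. -/
def flip {β : Type*} (E : Set β) : Equiv.Perm (E × Bool) :=
  Equiv.prodCongr (Equiv.refl E) Equiv.boolNot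

/-- Face tracing: traverse an edge from the given end to its other end, and leave along the
next edge-end in the rotation there. -/
def facePerm {α β : Type*} {G : Graph α β} (R : RotationSystem G) :
    Equiv.Perm (E(G) × Bool) :=
  R.rot * flip E(G)

/-- The number of faces, summed over the components of `G`, each embedded in its own surface.
A component with edges has one face for every cycle of the face-tracing permutation; an isolated
vertex lies on a sphere and has one face. -/
noncomputable def numFaces {α β : Type*} {G : Graph α β} (R : RotationSystem G) : ℕ :=
  Nat.card (Quotient (Equiv.Perm.SameCycle.setoid R.facePerm)) + G.numIsolated

/-- The embedding has (total) genus `g`. The Euler equation `|V| - |E| + |F| = 2 - 2 g` holds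
for each component with the genus of its surface, and these equations are added up. -/
def HasGenus {α β : Type*} {G : Graph α β} (R : RotationSystem G) (g : ℕ) : Prop :=
  (V(G).ncard : ℤ) - E(G).ncard + R.numFaces = 2 * G.numComponents - 2 * g

end RotationSystem

/-- The minimum genus `γ(G)`. -/
noncomputable def genus {α β : Type*} (G : Graph α β) : ℕ :=
  sInf {g : ℕ | ∃ R : RotationSystem G, R.HasGenus g}

/-- `G` with one new edge, named `none`, joining `u` and `v`. -/
def addEdge {α β : Type*} (G : Graph α β) (u v : α) : Graph α (Option β) where
  vertexSet := V(G) ∪ {u, v}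
  IsLink e x y := match e with
    | none => s(x, y) = s(u, v)
    | some e => G.IsLink e x y
  isLink_symm := by
    rintro (_ | e) -
    · exact ⟨fun x y h => (Sym2.eq_swap).trans h⟩
    · exact ⟨fun x y h => h.symm⟩
  eq_or_eq_of_isLink_of_isLink := by
    rintro (_ | e) x y a b h h'
    · have := h.trans h'.symm
      simp only [Sym2.eq_iff] at this
      tauto
    · exact h.left_eq_or_eq h'
  left_mem_of_isLink := by
    rintro (_ | e) x y h
    · simp only [Sym2.eq_iff] at h
      right
      simp only [Set.mem_insert_iff, Set.mem_singleton_iff]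
      tauto
    · exact Or.inl h.left_mem

/-- `S(G, {t})`: the three graphs formed by adding an edge between two points of the triple. -/
def tripleExtensions {α β : Type*} (G : Graph α β) (t : Fin 3 → α) :
    Set (Graph α (Option β)) :=
  {X | ∃ i j : Fin 3, i ≠ j ∧ X = G.addEdge (t i) (t j)}

/-- `γ_{T}(G)` for `T = {t}`: the minimum of `γ(X)` over the graphs `X ∈ S(G, T)`. -/
noncomputable def tripleGenus {α β : Type*} (G : Graph α β) (t : Fin 3 → α) : ℕ :=
  sInf (genus '' G.tripleExtensions t)

/-- The vertices of `H₃`: the two 3-valent vertices of `K_{2,3}`, its three 2-valent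
vertices, and a free node for each of the latter. -/
inductive H3Vertex where
  | pole (b : Bool)
  | mid (i : Fin 3)
  | free (i : Fin 3)

/-- The edges of `H₃`: the six edges of `K_{2,3}` and the three free edges. -/
inductive H3Edge where
  | spoke (i : Fin 3) (b : Bool)
  | freeEdge (i : Fin 3)

/-- The two ends of an edge of `H₃`. -/
def H3Edge.ends : H3Edge → Sym2 H3Vertex
  | .spoke i b => s(.mid i, .pole b)
  | .freeEdge i => s(.mid i, .free i)

/-- `H₃`: the graph `K_{2,3}` with a pendant vertex attached to each 2-valent vertex. -/
def H3 : Graph H3Vertex H3Edge where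
  vertexSet := Set.univ
  IsLink e x y := e.ends = s(x, y)
  isLink_symm := fun _ _ => ⟨fun _ _ h => h.trans Sym2.eq_swap⟩
  eq_or_eq_of_isLink_of_isLink := by
    intro e x y a b h h'
    have := h.symm.trans h'
    simp only [Sym2.eq_iff] at this
    tauto
  left_mem_of_isLink := fun _ _ _ _ => Set.mem_univ _

/-- The identification of the free nodes of `H₃` with the points of the triple `t`. -/
def glue {α : Type*} (t : Fin 3 → α) : H3Vertex → α ⊕ H3Vertex
  | .free i => Sum.inl (t i)
  | .pole b => Sum.inr (.pole b)
  | .mid i => Sum.inr (.mid i)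

/-- The scaffolded graph `H(G, {t})`: `G` together with a copy of `H₃` whose free nodes are
identified with the points of the triple `t`. -/
def scaffold {α β : Type*} (G : Graph α β) (t : Fin 3 → α) :
    Graph (α ⊕ H3Vertex) (β ⊕ H3Edge) where
  vertexSet := V(G.map Sum.inl) ∪ V(H3.map (glue t))
  IsLink e := match e with
    | Sum.inl e => (G.map Sum.inl).IsLink e
    | Sum.inr e => (H3.map (glue t)).IsLink e
  isLink_symm := by
    rintro (e | e) -
    · exact ⟨fun x y h => IsLink.symm h⟩
    · exact ⟨fun x y h => IsLink.symm h⟩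
  eq_or_eq_of_isLink_of_isLink := by
    rintro (e | e) x y a b h h'
    · exact IsLink.left_eq_or_eq h h'
    · exact IsLink.left_eq_or_eq h h'
  left_mem_of_isLink := by
    rintro (e | e) x y h
    · exact Or.inl (IsLink.left_mem h)
    · exact Or.inr (IsLink.left_mem h)

end Graph

/-! The faces of a rotation system are the cycles of rotation times edge flip on the set of
edge-ends (darts), so minimum genus means maximum cycle number. The whole argument compares cycle
numbers before and after `H₃` is attached.

Let `A` be the set of darts of `G` and `a` its edge flip. The inner vertices of `H₃` are disjoint
from `G`, so a rotation of the scaffolded graph splits (`exists_eq_gluedRot`) into a rotation `s` of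
`A ⊕ Fin 3`, that is, of `G` with one extra dart at each point of the triple, and a rotation at the
five inner vertices. These are 3-valent, so the second part is five bits `c`. Bypassing the 15 inner
darts one by one replaces `H₃` by a permutation `w` of the three extra darts: a face that enters
`H₃` at one free node leaves it at the next one under `w`. The number of scaffold faces is the
number of cycles of `s * sumCongr a w`, plus the number of faces lying wholly inside `H₃`
(`numCycles_gluedRot_mul`).

A finite check of the 32 choices (`h3Trace_cases`) shows that either `w` is a transposition and
exactly one face lies inside `H₃`, or `w` is the identity or a product of two transpositions and no
face does. Every transposition occurs. For `w = swap i j` the graph `H₃` acts as an edge joining `t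
i` and `t j`, with one extra face; the idle dart at the third point does not matter
(`exists_perm_pair`, `exists_perm_triple`). Any other `w` is one transposition away from some `swap
i j`, and a transposition changes the cycle number by one, so again there is at most one face more
than for a single edge (`exists_numCycles_gluedRot_le`).

Hence the maximal face number of the scaffolded graph exceeds by exactly one the largest among the
graphs `G + t i t j`. There are 5 more vertices and 8 more edges and the component number is the
same, so the Euler characteristic drops by 2 and the genus rises by 1. -/

/-! ### Counting cycles of permutations -/

namespace Setoid

/-- Joining two distinct classes of an equivalence relation lowers their number by one. -/
theorem card_quotient_join {X : Type*} [Finite X] (r s : Setoid X) (a b : X) (hab : ¬ r a b)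
    (h : ∀ x y, s x y ↔ r x y ∨ (r x a ∧ r b y) ∨ (r x b ∧ r a y)) :
    Nat.card (Quotient s) + 1 = Nat.card (Quotient r) := by
  classical
  have hrs : ∀ x y, r x y → s x y := fun x y hxy => (h x y).2 (Or.inl hxy)
  -- The class of `b` is absorbed by that of `a`, so the classes other than that of `b` biject with
  -- the classes of `s`.
  let f : ({(Quotient.mk r b)}ᶜ : Set (Quotient r)) → Quotient s :=
    fun q => Quotient.map' (s₁ := r) (s₂ := s) id hrs q.1
  have hf : Function.Bijective f := by
    constructor
    · rintro ⟨q, hq⟩ ⟨q', hq'⟩ hqq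
      induction q using Quotient.inductionOn with | h x => ?_
      induction q' using Quotient.inductionOn with | h y => ?_
      have h1 : s x y := Quotient.exact hqq
      have hx : ¬ r x b := fun hh => hq (Quotient.sound hh)
      have hy : ¬ r b y := fun hh => hq' (Quotient.sound (r.symm hh))
      have h2 : r x y := by
        rcases (h x y).1 h1 with h1 | h1 | h1
        · exact h1
        · exact absurd h1.2 hy
        · exact absurd h1.1 hx
      exact Subtype.ext (Quotient.sound h2)
    · intro q
      induction q using Quotient.inductionOn with | h x => ?_
      by_cases hx : r x b
      · refine ⟨⟨Quotient.mk r a, fun hh => hab (Quotient.exact hh)⟩, ?_⟩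
        exact Quotient.sound ((h a x).2 (Or.inr (Or.inl ⟨r.refl a, r.symm hx⟩)))
      · exact ⟨⟨Quotient.mk r x, fun hh => hx (Quotient.exact hh)⟩, rfl⟩
  have h1 := Nat.card_eq_of_bijective f hf
  have h2 := Set.ncard_add_ncard_compl ({(Quotient.mk r b)} : Set (Quotient r))
  rw [Set.ncard_singleton] at h2
  rw [← h1, Nat.card_coe_set_eq]
  omega

end Setoid

namespace Equiv.Perm

/-- The number of cycles of a permutation, fixed points included. -/
noncomputable def numCycles {D : Type*} (s : Perm D) : ℕ :=
  Nat.card (Quotient (SameCycle.setoid s))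

/-- On a finite type a cycle is exhausted by nonnegative powers, so forward closure suffices. This
is the induction principle for cycles used throughout. -/
theorem sameCycle_mem_of_closed {D : Type*} [Finite D] {s : Perm D} {x y : D} {A : D → Prop}
    (h : s.SameCycle x y) (hx : A x) (hA : ∀ z, A z → A (s z)) : A y := by
  obtain ⟨k, rfl⟩ := h.exists_nat_pow_eq
  clear h
  induction k with
  | zero => simpa using hx
  | succ k ih => rw [pow_succ', mul_apply]; exact hA _ ih

theorem sameCycle_rel_of_step {D : Type*} [Finite D] {s : Perm D} {x y : D} (r : Setoid D)
    (h : s.SameCycle x y) (hA : ∀ z, r z (s z)) : r x y :=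
  sameCycle_mem_of_closed (A := fun z => r x z) h (r.refl x) fun z hz => r.trans hz (hA z)

theorem sameCycle_mul_swap_self {D : Type*} [Finite D] [DecidableEq D] {s : Perm D} {a b : D}
    (hab : ¬ s.SameCycle a b) : (s * swap a b).SameCycle a b := by
  by_contra hcon
  have hne : a ≠ b := fun h => hab (h ▸ SameCycle.refl s a)
  set s' := s * swap a b with hs'
  have hb : s' b = s a := by simp [hs']
  have h1 : s'.SameCycle b (s a) ∧ s.SameCycle a (s a) :=
    ⟨by rw [← hb, sameCycle_apply_right], by rw [sameCycle_apply_right]⟩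
  have h2 : s.SameCycle (s a) a := by rw [sameCycle_apply_left]
  -- Follow the `s`-cycle from `s a = s' b` round to `a`. Under `hcon` the two permutations agree
  -- along the way, so the `s'`-cycle of `b` reaches `a` after all.
  have := sameCycle_mem_of_closed (A := fun z => s'.SameCycle b z ∧ s.SameCycle a z) h2 h1 ?_
  · exact hcon this.1.symm
  · rintro z ⟨hz, hz'⟩
    have hzb : z ≠ b := fun h => hab (h ▸ hz')
    have hza : z ≠ a := fun h => hcon (h ▸ hz).symm
    have : s z = s' z := by simp [hs', swap_apply_of_ne_of_ne hza hzb]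
    constructor
    · rw [this, sameCycle_apply_right]; exact hz
    · rw [sameCycle_apply_right]; exact hz'

/-- Multiplication with a transposition of points in two cycles joins these cycles. -/
theorem sameCycle_mul_swap {D : Type*} [Finite D] [DecidableEq D] {s : Perm D} {a b : D}
    (hab : ¬ s.SameCycle a b) (x y : D) : (s * swap a b).SameCycle x y ↔
      s.SameCycle x y ∨ (s.SameCycle x a ∧ s.SameCycle b y) ∨
        (s.SameCycle x b ∧ s.SameCycle a y) := by
  have key := sameCycle_mul_swap_self hab
  set s' := s * swap a b with hs'
  have hss : ∀ z w, s.SameCycle z w → s'.SameCycle z w := by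
    intro z w h
    refine sameCycle_rel_of_step (SameCycle.setoid s') h fun u => ?_
    change s'.SameCycle u (s u)
    by_cases hua : u = a
    · have : s u = s' b := by simp [hs', hua]
      rw [this, sameCycle_apply_right, hua]; exact key
    by_cases hub : u = b
    · have : s u = s' a := by simp [hs', hub]
      rw [this, sameCycle_apply_right, hub]; exact key.symm
    have : s u = s' u := by simp [hs', swap_apply_of_ne_of_ne hua hub]
    rw [this, sameCycle_apply_right]
  constructor
  · intro h
    refine sameCycle_mem_of_closed (A := fun y => s.SameCycle x y ∨
      (s.SameCycle x a ∧ s.SameCycle b y) ∨ (s.SameCycle x b ∧ s.SameCycle a y)) h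
      (Or.inl (SameCycle.refl s x)) fun z hz => ?_
    by_cases hza : z = a
    · have : s' z = s b := by simp [hs', hza]
      simp only [this, sameCycle_apply_right]
      subst hza
      rcases hz with h | h | h
      · exact Or.inr (Or.inl ⟨h, SameCycle.refl s b⟩)
      · exact absurd h.2.symm hab
      · exact Or.inl h.1
    by_cases hzb : z = b
    · have : s' z = s a := by simp [hs', hzb]
      simp only [this, sameCycle_apply_right]
      subst hzb
      rcases hz with h | h | h
      · exact Or.inr (Or.inr ⟨h, SameCycle.refl s a⟩)
      · exact Or.inl h.1
      · exact absurd h.2 hab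
    have : s' z = s z := by simp [hs', swap_apply_of_ne_of_ne hza hzb]
    simpa only [this, sameCycle_apply_right] using hz
  · rintro (h | ⟨h, h'⟩ | ⟨h, h'⟩)
    · exact hss _ _ h
    · exact (hss _ _ h).trans (key.trans (hss _ _ h'))
    · exact (hss _ _ h).trans (key.symm.trans (hss _ _ h'))

theorem numCycles_mul_swap_of_not_sameCycle {D : Type*} [Finite D] [DecidableEq D] {s : Perm D}
    {a b : D} (hab : ¬ s.SameCycle a b) : numCycles (s * swap a b) + 1 = numCycles s :=
  Setoid.card_quotient_join (SameCycle.setoid s) (SameCycle.setoid (s * swap a b)) a b hab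
    (sameCycle_mul_swap hab)

/-- Let `n` be least with `(s ^ n) b = a`. The arc `s b, …, (s ^ n) b = a` is closed under `s * swap
a b`, which sends `a` back to `s b`, and the arc misses `b`. -/
theorem not_sameCycle_mul_swap {D : Type*} [Finite D] [DecidableEq D] {s : Perm D} {a b : D}
    (hne : a ≠ b) (hab : s.SameCycle a b) : ¬ (s * swap a b).SameCycle a b := by
  intro hcon
  obtain ⟨k, hk⟩ : ∃ k : ℕ, (s ^ k) b = a := hab.symm.exists_nat_pow_eq
  classical
  have hex : ∃ k : ℕ, (s ^ k) b = a := ⟨k, hk⟩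
  set n := Nat.find hex with hn
  have hna : (s ^ n) b = a := Nat.find_spec hex
  have hn0 : 0 < n := by
    rcases Nat.eq_zero_or_pos n with h | h
    · rw [h] at hna; exact absurd hna.symm hne
    · exact h
  -- A return to `b` after `j` steps would give `a` already at time `n - j`, against minimality.
  have hnb : ∀ j, 0 < j → j ≤ n → (s ^ j) b ≠ b := by
    intro j hj hjn h
    refine Nat.find_min hex (m := n - j) (by omega) ?_
    have : (s ^ n) b = (s ^ (n - j)) ((s ^ j) b) := by
      rw [← mul_apply, ← pow_add]; congr 2; omega
    rw [← hna, this, h]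
  have := sameCycle_mem_of_closed (A := fun z => ∃ j, 0 < j ∧ j ≤ n ∧ (s ^ j) b = z) hcon
    ⟨n, hn0, le_rfl, hna⟩ ?_
  · obtain ⟨j, h1, h2, h3⟩ := this
    exact hnb j h1 h2 h3
  · rintro z ⟨j, h1, h2, rfl⟩
    rcases h2.lt_or_eq with h2' | h2'
    · have ha : (s ^ j) b ≠ a := Nat.find_min hex h2'
      refine ⟨j + 1, by omega, by omega, ?_⟩
      rw [mul_apply, swap_apply_of_ne_of_ne ha (hnb j h1 h2), pow_succ', mul_apply]
    · refine ⟨1, one_pos, hn0, ?_⟩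
      rw [h2', hna]; simp

theorem numCycles_mul_swap_of_sameCycle {D : Type*} [Finite D] [DecidableEq D] {s : Perm D}
    {a b : D} (hne : a ≠ b) (hab : s.SameCycle a b) :
    numCycles (s * swap a b) = numCycles s + 1 := by
  have h := numCycles_mul_swap_of_not_sameCycle (not_sameCycle_mul_swap hne hab)
  rw [mul_assoc, swap_mul_self, mul_one] at h
  exact h.symm

theorem numCycles_le_mul_swap {D : Type*} [Finite D] [DecidableEq D] (s : Perm D)
    {a b : D} (hne : a ≠ b) : numCycles s ≤ numCycles (s * swap a b) + 1 := by
  by_cases hab : s.SameCycle a b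
  · rw [numCycles_mul_swap_of_sameCycle hne hab]; omega
  · exact (numCycles_mul_swap_of_not_sameCycle hab).ge

theorem numCycles_mul_swap_le {D : Type*} [Finite D] [DecidableEq D] (s : Perm D)
    {a b : D} (hne : a ≠ b) : numCycles (s * swap a b) ≤ numCycles s + 1 := by
  have := numCycles_le_mul_swap (s * swap a b) hne
  rwa [mul_assoc, swap_mul_self, mul_one] at this

/-! ### Conjugation, disjoint sums, and prescribed cycles -/

theorem sameCycle_permCongr {D D' : Type*} (e : D ≃ D') (s : Perm D) (x y : D) :
    (e.permCongr s).SameCycle (e x) (e y) ↔ s.SameCycle x y := by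
  have hp : ∀ i : ℤ, (e.permCongr s) ^ i = e.permCongr (s ^ i) := fun i =>
    (map_zpow e.permCongrHom s i).symm
  simp only [SameCycle, hp, Equiv.permCongr_apply, Equiv.symm_apply_apply,
    EmbeddingLike.apply_eq_iff_eq]

theorem numCycles_permCongr {D D' : Type*} (e : D ≃ D') (s : Perm D) :
    numCycles (e.permCongr s) = numCycles s :=
  (Nat.card_congr (Quotient.congr e fun x y => (sameCycle_permCongr e s x y).symm)).symm

theorem permCongr_mul' {D D' : Type*} (e : D ≃ D') (s t : Perm D) :
    e.permCongr (s * t) = e.permCongr s * e.permCongr t :=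
  map_mul e.permCongrHom s t

theorem numCycles_mul_comm {D : Type*} (s t : Perm D) :
    numCycles (s * t) = numCycles (t * s) := by
  have : t * s = (t : D ≃ D).permCongr (s * t) := by
    ext x; simp
  rw [this, numCycles_permCongr]

theorem numCycles_swap_mul_of_not_sameCycle {D : Type*} [Finite D] [DecidableEq D] {s : Perm D}
    {a b : D} (hab : ¬ s.SameCycle a b) : numCycles (swap a b * s) + 1 = numCycles s := by
  rw [numCycles_mul_comm]; exact numCycles_mul_swap_of_not_sameCycle hab

theorem numCycles_swap_mul_of_sameCycle {D : Type*} [Finite D] [DecidableEq D] {s : Perm D}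
    {a b : D} (hne : a ≠ b) (hab : s.SameCycle a b) :
    numCycles (swap a b * s) = numCycles s + 1 := by
  rw [numCycles_mul_comm]; exact numCycles_mul_swap_of_sameCycle hne hab

theorem sameCycle_sumCongr_inl {A B : Type*} (s : Perm A) (t : Perm B) (x y : A) :
    (sumCongr s t).SameCycle (Sum.inl x) (Sum.inl y) ↔ s.SameCycle x y := by
  have hp : ∀ i : ℤ, (sumCongr s t) ^ i = sumCongr (s ^ i) (t ^ i) := fun i =>
    (map_zpow (sumCongrHom A B) (s, t) i).symm
  simp [SameCycle, hp]

theorem sameCycle_sumCongr_inr {A B : Type*} (s : Perm A) (t : Perm B) (x y : B) :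
    (sumCongr s t).SameCycle (Sum.inr x) (Sum.inr y) ↔ t.SameCycle x y := by
  have hp : ∀ i : ℤ, (sumCongr s t) ^ i = sumCongr (s ^ i) (t ^ i) := fun i =>
    (map_zpow (sumCongrHom A B) (s, t) i).symm
  simp [SameCycle, hp]

theorem not_sameCycle_sumCongr {A B : Type*} (s : Perm A) (t : Perm B) (x : A) (y : B) :
    ¬ (sumCongr s t).SameCycle (Sum.inl x) (Sum.inr y) := by
  have hp : ∀ i : ℤ, (sumCongr s t) ^ i = sumCongr (s ^ i) (t ^ i) := fun i =>
    (map_zpow (sumCongrHom A B) (s, t) i).symm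
  simp [SameCycle, hp]

theorem numCycles_sumCongr {A B : Type*} [Finite A] [Finite B] (s : Perm A) (t : Perm B) :
    numCycles (sumCongr s t) = numCycles s + numCycles t := by
  unfold numCycles
  rw [← Nat.card_sum]
  refine (Nat.card_eq_of_bijective (Sum.elim
    (Quotient.map' (s₁ := SameCycle.setoid s) (s₂ := SameCycle.setoid (sumCongr s t)) Sum.inl
      fun x y h => (sameCycle_sumCongr_inl s t x y).2 h)
    (Quotient.map' (s₁ := SameCycle.setoid t) (s₂ := SameCycle.setoid (sumCongr s t)) Sum.inr
      fun x y h => (sameCycle_sumCongr_inr s t x y).2 h)) ⟨?_, ?_⟩).symm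
  · rintro (q | q) (q' | q') h <;>
      induction q using Quotient.inductionOn with | h x => ?_ <;>
      induction q' using Quotient.inductionOn with | h y => ?_
    · exact congrArg _ (Quotient.sound ((sameCycle_sumCongr_inl s t x y).1 (Quotient.exact h)))
    · exact absurd (Quotient.exact h) (not_sameCycle_sumCongr s t x y)
    · exact absurd (SameCycle.symm (Quotient.exact h)) (not_sameCycle_sumCongr s t y x)
    · exact congrArg _ (Quotient.sound ((sameCycle_sumCongr_inr s t x y).1 (Quotient.exact h)))
  · intro q
    induction q using Quotient.inductionOn with | h x => ?_
    rcases x with x | x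
    · exact ⟨Sum.inl (Quotient.mk (SameCycle.setoid s) x), rfl⟩
    · exact ⟨Sum.inr (Quotient.mk (SameCycle.setoid t) x), rfl⟩

theorem numCycles_one {D : Type*} : numCycles (1 : Perm D) = Nat.card D := by
  refine (Nat.card_eq_of_bijective (Quotient.mk (SameCycle.setoid (1 : Perm D))) ⟨?_, ?_⟩).symm
  · intro x y h
    exact sameCycle_one.1 (Quotient.exact h)
  · exact Quotient.mk_surjective

/-- The number of cycles, when the cycles are the fibres of a map. -/
theorem numCycles_eq_ncard_range {D X : Type*} (s : Perm D) (v : D → X)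
    (h : ∀ x y, s.SameCycle x y ↔ v x = v y) : numCycles s = (Set.range v).ncard := by
  rw [← Nat.card_coe_set_eq]
  refine Nat.card_eq_of_bijective
    (Quotient.lift (s := SameCycle.setoid s) (Set.rangeFactorization v) fun x y hxy =>
      Subtype.ext ((h x y).1 hxy)) ⟨?_, ?_⟩
  · intro q q' hq
    induction q using Quotient.inductionOn with | h x => ?_
    induction q' using Quotient.inductionOn with | h y => ?_
    exact Quotient.sound ((h x y).2 (congrArg Subtype.val hq))
  · rintro ⟨_, x, rfl⟩
    exact ⟨Quotient.mk _ x, rfl⟩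

/-- There is a permutation whose cycles are the fibres of a given map. -/
theorem exists_sameCycle_iff {D X : Type*} [Finite D] (v : D → X) :
    ∃ s : Perm D, ∀ x y, s.SameCycle x y ↔ v x = v y := by
  have hc : ∀ c : X, ∃ s : Perm {d // v d = c}, ∀ x y, s.SameCycle x y := by
    intro c
    have := Fintype.ofFinite {d // v d = c}
    classical
    obtain ⟨s, hs, -⟩ := (Finset.univ : Finset {d // v d = c}).exists_cycleOn
    exact ⟨s, fun x y => hs.2 (by simp) (by simp)⟩
  choose s hs using hc
  refine ⟨(Equiv.sigmaFiberEquiv v).permCongr (Equiv.Perm.sigmaCongrRight s), ?_⟩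
  have hp : ∀ i : ℤ, (Equiv.Perm.sigmaCongrRight s) ^ i
      = Equiv.Perm.sigmaCongrRight (s ^ i) := fun i =>
    (map_zpow (sigmaCongrRightHom fun c => {d // v d = c}) s i).symm
  intro x y
  obtain ⟨⟨c, x, hx⟩, rfl⟩ := (Equiv.sigmaFiberEquiv v).surjective x
  obtain ⟨⟨c', y, hy⟩, rfl⟩ := (Equiv.sigmaFiberEquiv v).surjective y
  rw [sameCycle_permCongr]
  simp only [Equiv.sigmaFiberEquiv_apply, hx, hy]
  constructor
  · rintro ⟨i, hi⟩
    rw [hp] at hi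
    exact congrArg Sigma.fst hi
  · rintro rfl
    obtain ⟨i, hi⟩ := hs c ⟨x, hx⟩ ⟨y, hy⟩
    exact ⟨i, by rw [hp]; exact congrArg (Sigma.mk c) hi⟩

end Equiv.Perm

/-! ### Eliminating darts -/

namespace Equiv.Perm

/-- The new second factor fixes `x` and sends the former predecessor of `x` straight to `b x`. Since
`s` fixes `x`, this splits `x` off its cycle in the product as a fixed point, a gain of one cycle
unless `x` was already fixed. -/
theorem numCycles_mul_swap_apply_mul {D : Type*} [Finite D] [DecidableEq D] (s b : Perm D) (x : D)
    (hx : s x = x) : numCycles (s * (swap x (b x) * b)) =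
      numCycles (s * b) + if b x = x then 0 else 1 := by
  split_ifs with h
  · rw [h, swap_self]; rfl
  · have h1 : s * (swap x (b x) * b) = swap x ((s * b) x) * (s * b) := by
      rw [← mul_assoc, mul_swap_eq_swap_mul, hx, mul_assoc]; rfl
    rw [h1, numCycles_swap_mul_of_sameCycle]
    · intro h2
      rw [mul_apply] at h2
      exact h (s.injective (h2.symm.trans hx.symm))
    · rw [sameCycle_apply_right]

/-- Take the points of a list out of their cycles, and count those that were not fixed. -/
def eliminate {K : Type*} [DecidableEq K] : List K → Perm K → Perm K × ℕ
  | [], b => (b, 0)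
  | x :: l, b =>
    ((eliminate l (swap x (b x) * b)).1,
      (eliminate l (swap x (b x) * b)).2 + if b x = x then 0 else 1)

/-- The computation of `eliminate` involves only `b`, not `s` or `a`. Thus the effect of `H₃` on the
faces can be computed once, independently of `G`. -/
theorem numCycles_mul_eliminate {A K : Type*} [Finite A] [Finite K] [DecidableEq K]
    (s : Perm (A ⊕ K)) (a : Perm A) (l : List K)
    (hl : ∀ x ∈ l, s (Sum.inr x) = Sum.inr x) (b : Perm K) :
    numCycles (s * sumCongr a (eliminate l b).1) =
      numCycles (s * sumCongr a b) + (eliminate l b).2 := by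
  classical
  induction l generalizing b with
  | nil => rfl
  | cons x l ih =>
    simp only [eliminate]
    rw [ih (fun y hy => hl y (List.mem_cons_of_mem _ hy))]
    have h1 : sumCongr a (swap x (b x) * b) =
        swap (Sum.inr x) (sumCongr a b (Sum.inr x)) * sumCongr a b := by
      rw [sumCongr_apply, Sum.map_inr, ← sumCongr_one_swap, sumCongr_mul, one_mul]
    rw [h1, numCycles_mul_swap_apply_mul _ _ _ (hl x List.mem_cons_self)]
    simp only [sumCongr_apply, Sum.map_inr, Sum.inr.injEq]
    omega

end Equiv.Perm

/-! ### The darts of `H₃` -/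

namespace Graph

open Equiv Equiv.Perm

/-- The edge-ends of `H₃` at the vertices other than the free nodes: three at every vertex. -/
abbrev InnerDart := (Fin 3 ⊕ Bool) × Fin 3

/-- The edge-ends of `H₃`; `Sum.inl i` is the one at the free node `i`. -/
abbrev H3Dart := Fin 3 ⊕ InnerDart

/-- The other end of an edge of `H₃`. -/
def h3Opp : H3Dart → H3Dart
  | .inl i => .inr (.inl i, 2)
  | .inr (.inl i, 2) => .inl i
  | .inr (.inl i, 0) => .inr (.inr false, i)
  | .inr (.inl i, 1) => .inr (.inr true, i)
  | .inr (.inr false, i) => .inr (.inl i, 0)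
  | .inr (.inr true, i) => .inr (.inl i, 1)

theorem h3Opp_involutive : Function.Involutive h3Opp := by
  unfold Function.Involutive; decide

/-- The involution interchanging the ends of every edge of `H₃`. -/
def h3Flip : Perm H3Dart := h3Opp_involutive.toPerm

/-- The two cyclic orders of the edge-ends at the inner vertices of `H₃`. -/
def innerRot (c : Fin 3 ⊕ Bool → Bool) : Perm InnerDart :=
  Equiv.prodCongrRight fun p => if c p then Equiv.addRight 1 else Equiv.addRight 2

/-- The choice of cyclic orders that is described by five bits. -/
def innerChoice (c₀ c₁ c₂ d₀ d₁ : Bool) : Fin 3 ⊕ Bool → Bool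
  | .inl 0 => c₀
  | .inl 1 => c₁
  | .inl 2 => c₂
  | .inr false => d₀
  | .inr true => d₁

/-- All edge-ends at inner vertices. -/
def innerDarts : List H3Dart :=
  [.inr (.inl 0, 0), .inr (.inl 0, 1), .inr (.inl 0, 2),
    .inr (.inl 1, 0), .inr (.inl 1, 1), .inr (.inl 1, 2),
    .inr (.inl 2, 0), .inr (.inl 2, 1), .inr (.inl 2, 2),
    .inr (.inr false, 0), .inr (.inr false, 1), .inr (.inr false, 2),
    .inr (.inr true, 0), .inr (.inr true, 1), .inr (.inr true, 2)]

/-- The effect of `H₃` on face tracing in the rest of the graph. -/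
def h3Trace (c : Fin 3 ⊕ Bool → Bool) : Perm H3Dart × ℕ :=
  eliminate innerDarts (sumCongr 1 (innerRot c) * h3Flip)

set_option synthInstance.maxHeartbeats 400000 in
set_option synthInstance.maxSize 100000 in
set_option maxRecDepth 100000 in
-- The difference of 15 and the second component is the number of faces lying wholly inside `H₃`:
-- each such face leaves exactly one dart that is already fixed when its turn comes. Parity couples
-- the two components: the inner rotations are even and the flip of nine edges is odd, so 15 goes
-- with an even permutation and 14 with an odd one.
theorem h3Trace_cases (c₀ c₁ c₂ d₀ d₁ : Bool) :
    h3Trace (innerChoice c₀ c₁ c₂ d₀ d₁) = (1, 15) ∨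
    (∃ i j : Fin 3, i ≠ j ∧
      h3Trace (innerChoice c₀ c₁ c₂ d₀ d₁) = (sumCongr (swap i j) 1, 14)) ∨
    (∃ i j k : Fin 3, i ≠ j ∧ j ≠ k ∧
      h3Trace (innerChoice c₀ c₁ c₂ d₀ d₁) = (sumCongr (swap i j * swap j k) 1, 15)) := by
  revert c₀ c₁ c₂ d₀ d₁
  decide +kernel

set_option synthInstance.maxHeartbeats 400000 in
set_option synthInstance.maxSize 100000 in
theorem exists_h3Trace_eq_swap (i j : Fin 3) (hij : i ≠ j) : ∃ c₀ c₁ c₂ d₀ d₁ : Bool,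
    h3Trace (innerChoice c₀ c₁ c₂ d₀ d₁) = (sumCongr (swap i j) 1, 14) := by
  revert i j
  decide +kernel

end Graph

/-! ### The Euler equation -/

namespace Graph

open Equiv Equiv.Perm

variable {α β : Type*} {G : Graph α β}

namespace RotationSystem

theorem vertexAt_mem (R : RotationSystem G) (d : E(G) × Bool) : R.vertexAt d ∈ V(G) := by
  rcases d with ⟨e, _ | _⟩
  · exact (R.isLink_vertexAt e).left_mem
  · exact (R.isLink_vertexAt e).right_mem

theorem numCycles_rot_add_numIsolated (R : RotationSystem G) (hV : V(G).Finite) :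
    numCycles R.rot + G.numIsolated = V(G).ncard := by
  rw [numCycles_eq_ncard_range R.rot R.vertexAt R.sameCycle_rot_iff, numIsolated]
  have hr : Set.range R.vertexAt = {v | v ∈ V(G) ∧ ∃ e, G.Inc e v} := by
    ext v
    constructor
    · rintro ⟨d, rfl⟩
      refine ⟨R.vertexAt_mem d, d.1, ?_⟩
      rcases d with ⟨e, _ | _⟩
      · exact (R.isLink_vertexAt e).inc_left
      · exact (R.isLink_vertexAt e).inc_right
    · rintro ⟨-, e, he⟩
      rcases he.eq_or_eq_of_isLink (R.isLink_vertexAt ⟨e, he.edge_mem⟩) with h | h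
      · exact ⟨_, h.symm⟩
      · exact ⟨_, h.symm⟩
  have hfin : ∀ p : α → Prop, {v | v ∈ V(G) ∧ p v}.Finite := fun p => hV.subset fun v hv => hv.1
  rw [hr, ← Set.ncard_union_eq (hs := hfin _) (ht := hfin _)]
  · congr 1
    ext v
    simp only [Set.mem_union, Set.mem_ofPred_eq]
    by_cases h : ∃ e, G.Inc e v
    · simp [h]
    · simp only [h, and_false, false_or]
      simp only [not_exists] at h
      simp [h]
  · rw [Set.disjoint_left]
    rintro v ⟨-, e, he⟩ ⟨-, h⟩
    exact h e he

end RotationSystem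

/-- Interchange the two ends of every edge in `S`. -/
def flipOn {E : Type*} [DecidableEq E] (S : Finset E) : Perm (E × Bool) :=
  Equiv.prodCongrRight fun e => if e ∈ S then Equiv.boolNot else Equiv.refl Bool

theorem flipOn_insert {E : Type*} [DecidableEq E] (S : Finset E) (e : E) (he : e ∉ S) :
    flipOn (insert e S) = flipOn S * swap (e, false) (e, true) := by
  ext1 ⟨f, b⟩
  by_cases hf : f = e
  · subst hf
    cases b <;> simp [flipOn, he]
  · have h : swap (e, false) (e, true) (f, b) = (f, b) :=
      swap_apply_of_ne_of_ne (by simp [hf]) (by simp [hf])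
    rw [Perm.mul_apply, h]
    simp [flipOn, hf]

/-- The relation of being joined by a walk through edges in `S`. -/
def walkSetoid (G : Graph α β) (S : Finset E(G)) : Setoid V(G) :=
  Relation.EqvGen.setoid fun x y => ∃ e ∈ S, G.IsLink e.1 x y

/-- The shape is that of the hypothesis of `Setoid.card_quotient_join`, so a new edge between two
components lowers their number by one. -/
theorem walkSetoid_insert [DecidableEq E(G)] (S : Finset E(G)) (e : E(G)) (a b : V(G))
    (hab : G.IsLink e a b) (x y : V(G)) : G.walkSetoid (insert e S) x y ↔
      G.walkSetoid S x y ∨ (G.walkSetoid S x a ∧ G.walkSetoid S b y) ∨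
        (G.walkSetoid S x b ∧ G.walkSetoid S a y) := by
  set r := G.walkSetoid S
  set s := G.walkSetoid (insert e S)
  have hrs : ∀ x y, r x y → s x y := by
    intro x y h
    exact Relation.EqvGen.mono (fun x y ⟨e, he, h⟩ => ⟨e, Finset.mem_insert_of_mem he, h⟩) x y h
  have hs : s a b := Relation.EqvGen.rel _ _ ⟨e, Finset.mem_insert_self _ _, hab⟩
  constructor
  · intro h
    induction h with
    | rel x y h =>
      obtain ⟨f, hf, h⟩ := h
      rcases Finset.mem_insert.1 hf with rfl | hf
      · rcases hab.eq_and_eq_or_eq_and_eq h with ⟨h1, h2⟩ | ⟨h1, h2⟩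
        · rw [← Subtype.ext h1, ← Subtype.ext h2]
          exact Or.inr (Or.inl ⟨r.refl a, r.refl b⟩)
        · rw [← Subtype.ext h1, ← Subtype.ext h2]
          exact Or.inr (Or.inr ⟨r.refl b, r.refl a⟩)
      · exact Or.inl (Relation.EqvGen.rel _ _ ⟨f, hf, h⟩)
    | refl x => exact Or.inl (r.refl x)
    | symm x y _ ih =>
      rcases ih with h | ⟨h, h'⟩ | ⟨h, h'⟩
      · exact Or.inl (r.symm h)
      · exact Or.inr (Or.inr ⟨r.symm h', r.symm h⟩)
      · exact Or.inr (Or.inl ⟨r.symm h', r.symm h⟩)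
    | trans x y z _ _ ih1 ih2 =>
      rcases ih1 with h | ⟨h, h'⟩ | ⟨h, h'⟩ <;> rcases ih2 with k | ⟨k, k'⟩ | ⟨k, k'⟩
      · exact Or.inl (r.trans h k)
      · exact Or.inr (Or.inl ⟨r.trans h k, k'⟩)
      · exact Or.inr (Or.inr ⟨r.trans h k, k'⟩)
      · exact Or.inr (Or.inl ⟨h, r.trans h' k⟩)
      · exact Or.inr (Or.inl ⟨h, k'⟩)
      · exact Or.inl (r.trans h k')
      · exact Or.inr (Or.inr ⟨h, r.trans h' k⟩)
      · exact Or.inl (r.trans h k')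
      · exact Or.inr (Or.inr ⟨h, k'⟩)
  · rintro (h | ⟨h, h'⟩ | ⟨h, h'⟩)
    · exact hrs _ _ h
    · exact s.trans (hrs _ _ h) (s.trans hs (hrs _ _ h'))
    · exact s.trans (hrs _ _ h) (s.trans (s.symm hs) (hrs _ _ h'))

namespace RotationSystem

/-- A face stays within one component; hence an edge between two components always joins two
different faces. -/
theorem walkSetoid_of_sameCycle [DecidableEq E(G)] [Finite E(G)] (R : RotationSystem G)
    (S : Finset E(G)) (d d' : E(G) × Bool) (h : (R.rot * flipOn S).SameCycle d d') :
    G.walkSetoid S ⟨R.vertexAt d, R.vertexAt_mem d⟩ ⟨R.vertexAt d', R.vertexAt_mem d'⟩ := by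
  refine sameCycle_rel_of_step ((G.walkSetoid S).comap fun d =>
    ⟨R.vertexAt d, R.vertexAt_mem d⟩) h fun z => ?_
  have h1 : R.vertexAt ((R.rot * flipOn S) z) = R.vertexAt (flipOn S z) :=
    (R.sameCycle_rot_iff _ _).1 (by rw [Perm.mul_apply, sameCycle_apply_left])
  simp only [Setoid.comap_rel, h1]
  rcases z with ⟨e, b⟩
  by_cases he : e ∈ S
  · refine Relation.EqvGen.rel _ _ ⟨e, he, ?_⟩
    have := R.isLink_vertexAt e
    cases b
    · simpa [flipOn, he] using this
    · simpa [flipOn, he] using this.symm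
  · have : flipOn S (e, b) = (e, b) := by simp [flipOn, he]
    simp only [this]
    exact (G.walkSetoid S).refl _

/-- Edges are inserted one at a time, starting from one cycle per non-isolated vertex. Inserting an
edge multiplies the face permutation by a transposition, and `g` counts the handles that this
forces. -/
theorem euler_flipOn [DecidableEq E(G)] (R : RotationSystem G) (hV : V(G).Finite)
    (hE : E(G).Finite) (S : Finset E(G)) :
    ∃ g : ℕ, V(G).ncard + numCycles (R.rot * flipOn S) + G.numIsolated + 2 * g =
      S.card + 2 * Nat.card (Quotient (G.walkSetoid S)) := by
  have := hV.to_subtype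
  have := hE.to_subtype
  induction S using Finset.induction_on with
  | empty =>
    refine ⟨0, ?_⟩
    have h1 : flipOn (∅ : Finset E(G)) = 1 := by
      ext1 ⟨e, b⟩; simp [flipOn]
    have h2 : Nat.card (Quotient (G.walkSetoid ∅)) = V(G).ncard := by
      rw [← Nat.card_coe_set_eq]
      refine (Nat.card_eq_of_bijective (Quotient.mk (G.walkSetoid ∅))
        ⟨fun x y h => ?_, Quotient.mk_surjective⟩).symm
      have h' : Relation.EqvGen _ x y := Quotient.exact h
      clear h
      induction h' with
      | rel x y h => obtain ⟨e, he, -⟩ := h; simp at he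
      | refl x => rfl
      | symm x y _ ih => exact ih.symm
      | trans x y z _ _ ih1 ih2 => exact ih1.trans ih2
    have := R.numCycles_rot_add_numIsolated hV
    rw [h1, mul_one, h2, Finset.card_empty]
    omega
  | insert e S he ih =>
    obtain ⟨g, hg⟩ := ih
    rw [flipOn_insert S e he, ← mul_assoc, Finset.card_insert_of_notMem he]
    set a : E(G) × Bool := (e, false)
    set b : E(G) × Bool := (e, true)
    have hne : a ≠ b := by simp [a, b]
    have hins := walkSetoid_insert S e ⟨R.vertexAt a, R.vertexAt_mem a⟩
      ⟨R.vertexAt b, R.vertexAt_mem b⟩ (R.isLink_vertexAt e)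
    by_cases hr : G.walkSetoid S ⟨R.vertexAt a, R.vertexAt_mem a⟩
      ⟨R.vertexAt b, R.vertexAt_mem b⟩
    · have heq : G.walkSetoid (insert e S) = G.walkSetoid S := by
        ext x y
        rw [hins]
        constructor
        · rintro (h | ⟨h, h'⟩ | ⟨h, h'⟩)
          · exact h
          · exact Setoid.trans' _ h (Setoid.trans' _ hr h')
          · exact Setoid.trans' _ h (Setoid.trans' _ (Setoid.symm' _ hr) h')
        · exact Or.inl
      rw [heq]
      -- Within a component, an edge with both ends in one face splits that face; an edge between
      -- two faces merges them at the cost of a handle.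
      by_cases hc : (R.rot * flipOn S).SameCycle a b
      · refine ⟨g, ?_⟩
        rw [numCycles_mul_swap_of_sameCycle hne hc]
        omega
      · refine ⟨g + 1, ?_⟩
        have := numCycles_mul_swap_of_not_sameCycle hc
        omega
    · refine ⟨g, ?_⟩
      have h1 := numCycles_mul_swap_of_not_sameCycle
        (fun hc => hr (R.walkSetoid_of_sameCycle S a b hc))
      have h2 := Setoid.card_quotient_join _ _ _ _ hr hins
      omega

/-- Every rotation system of a finite graph has a genus. -/
theorem exists_hasGenus (R : RotationSystem G) (hV : V(G).Finite) (hE : E(G).Finite) :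
    ∃ g : ℕ, R.HasGenus g := by
  classical
  have := hE.to_subtype
  have := Fintype.ofFinite E(G)
  obtain ⟨g, hg⟩ := R.euler_flipOn hV hE Finset.univ
  refine ⟨g, ?_⟩
  have h1 : R.rot * flipOn Finset.univ = R.facePerm := by
    unfold facePerm
    congr 1
    ext1 ⟨e, b⟩
    simp [flipOn, flip]
  have h2 : Nat.card (Quotient (G.walkSetoid Finset.univ)) = G.numComponents := by
    refine (Nat.card_eq_of_bijective (Quot.lift (Quotient.mk (G.walkSetoid Finset.univ))
      fun x y h => Quotient.sound ?_) ⟨?_, ?_⟩).symm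
    · obtain ⟨e, he⟩ := h
      exact Relation.EqvGen.rel _ _ ⟨⟨e, he.edge_mem⟩, Finset.mem_univ _, he⟩
    · intro q q' h
      induction q using Quot.inductionOn with | h x => ?_
      induction q' using Quot.inductionOn with | h y => ?_
      refine Quot.eqvGen_sound (Relation.EqvGen.mono ?_ _ _ (Quotient.exact h))
      rintro x y ⟨e, -, he⟩
      exact ⟨e, he⟩
    · intro q
      obtain ⟨x, rfl⟩ := Quotient.exists_rep q
      exact ⟨Quot.mk _ x, rfl⟩
  have h3 : (Finset.univ : Finset E(G)).card = E(G).ncard := by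
    rw [← Nat.card_coe_set_eq, Nat.card_eq_fintype_card, Finset.card_univ]
  rw [h1, h2, h3] at hg
  have h4 : R.numFaces = numCycles R.facePerm + G.numIsolated := rfl
  unfold HasGenus
  rw [h4]
  push_cast
  omega

end RotationSystem

/-- The ends of the edges, named in an arbitrary way. -/
theorem exists_vertexAt (G : Graph α β) : ∃ v : E(G) × Bool → α,
    ∀ e : E(G), G.IsLink e (v (e, false)) (v (e, true)) := by
  have : ∀ e : E(G), ∃ x y, G.IsLink e x y := fun e => exists_isLink_of_mem_edgeSet e.2
  choose x y h using this
  exact ⟨fun d => if d.2 then y d.1 else x d.1, fun e => by simpa using h e⟩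

theorem exists_rotationSystem (hE : E(G).Finite) : Nonempty (RotationSystem G) := by
  have := hE.to_subtype
  obtain ⟨v, hv⟩ := G.exists_vertexAt
  obtain ⟨s, hs⟩ := exists_sameCycle_iff v
  exact ⟨⟨v, hv, s, hs⟩⟩

/-- The minimum genus is attained. -/
theorem exists_hasGenus_genus (hV : V(G).Finite) (hE : E(G).Finite) :
    ∃ R : RotationSystem G, R.HasGenus G.genus := by
  obtain ⟨R⟩ := exists_rotationSystem hE
  obtain ⟨g, hg⟩ := R.exists_hasGenus hV hE
  exact Nat.sInf_mem (s := {g : ℕ | ∃ R : RotationSystem G, R.HasGenus g}) ⟨g, R, hg⟩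

theorem genus_le (R : RotationSystem G) {g : ℕ} (h : R.HasGenus g) : G.genus ≤ g :=
  Nat.sInf_le ⟨R, h⟩

/-- Graphs with corresponding components have the same number of components. -/
theorem numComponents_congr {α' β' : Type*} {X : Graph α β} {Y : Graph α' β'}
    (f : V(X) → V(Y)) (g : V(Y) → V(X))
    (hf : ∀ x y : V(X), X.Adj x y → Relation.EqvGen (fun x y : V(Y) => Y.Adj x y) (f x) (f y))
    (hg : ∀ x y : V(Y), Y.Adj x y → Relation.EqvGen (fun x y : V(X) => X.Adj x y) (g x) (g y))
    (hgf : ∀ x, Relation.EqvGen (fun x y : V(X) => X.Adj x y) (g (f x)) x)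
    (hfg : ∀ y, Relation.EqvGen (fun x y : V(Y) => Y.Adj x y) (f (g y)) y) :
    X.numComponents = Y.numComponents :=
  Nat.card_congr
    { toFun := Quot.lift (fun x => Quot.mk _ (f x)) fun x y h => Quot.eqvGen_sound (hf x y h)
      invFun := Quot.lift (fun x => Quot.mk _ (g x)) fun x y h => Quot.eqvGen_sound (hg x y h)
      left_inv := by rintro ⟨x⟩; exact Quot.eqvGen_sound (hgf x)
      right_inv := by rintro ⟨x⟩; exact Quot.eqvGen_sound (hfg x) }

theorem Reachable.eqvGen {u v : α} (h : G.Reachable u v) (hu : u ∈ V(G)) (hv : v ∈ V(G)) :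
    Relation.EqvGen (fun x y : V(G) => G.Adj x y) ⟨u, hu⟩ ⟨v, hv⟩ := by
  unfold Reachable at h
  induction h with
  | refl => exact Relation.EqvGen.refl _
  | tail h1 h2 ih =>
    exact (ih h2.left_mem).trans _ _ _ (Relation.EqvGen.rel _ _ h2)

end Graph

/-! ### Inserting and removing a dart -/

namespace Equiv.Perm

theorem optionCongr_eq_permCongr {D : Type*} (r : Perm D) :
    optionCongr r = (Equiv.optionEquivSumPUnit.{0} D).symm.permCongr (sumCongr r 1) := by
  ext1 x
  cases x <;> simp [Equiv.permCongr_apply]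

theorem sameCycle_optionCongr {D : Type*} (r : Perm D) (x y : D) :
    SameCycle (optionCongr r : Perm (Option D)) (some x) (some y) ↔ r.SameCycle x y := by
  rw [optionCongr_eq_permCongr, ← sameCycle_sumCongr_inl r (1 : Perm PUnit.{1}),
    ← sameCycle_permCongr (Equiv.optionEquivSumPUnit.{0} D).symm]
  simp

theorem not_sameCycle_optionCongr {D : Type*} (r : Perm D) (x : D) :
    ¬ SameCycle (optionCongr r : Perm (Option D)) none (some x) := by
  intro h
  have := h.eq_of_left (by simp [Function.IsFixedPt])
  simp at this

theorem numCycles_optionCongr {D : Type*} [Finite D] (r : Perm D) :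
    numCycles (optionCongr r : Perm (Option D)) = numCycles r + 1 := by
  rw [optionCongr_eq_permCongr, numCycles_permCongr, numCycles_sumCongr, numCycles_one]
  simp

/-- Insert the new point `none` into the cycle of `z`. -/
def insertNone {D : Type*} [DecidableEq D] (r : Perm D) (z : D) : Perm (Option D) :=
  (optionCongr r : Perm (Option D)) * swap none (some z)

/-- Delete `none` from its cycle with `removeNone`; `z` is the point that preceded it. -/
theorem exists_eq_insertNone {D : Type*} [DecidableEq D] (s : Perm (Option D))
    (hs : s none ≠ none) : ∃ r z, s = insertNone r z := by
  obtain ⟨y, hy⟩ := Option.ne_none_iff_exists'.1 hs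
  have h := map_equiv_removeNone s
  refine ⟨removeNone s, (removeNone s).symm y, ?_⟩
  have h2 : s = swap none (some y) * (optionCongr (removeNone s) : Perm (Option D)) := by
    rw [h, hy, ← mul_assoc, swap_mul_self, one_mul]
  rw [insertNone, mul_swap_eq_swap_mul]
  simp only [optionCongr_apply, Option.map_none, Option.map_some, Equiv.apply_symm_apply]
  exact h2

section

variable {D : Type*} [Finite D] [DecidableEq D] (r : Perm D) (z : D)

theorem sameCycle_insertNone_some (x y : D) :
    (insertNone r z).SameCycle (some x) (some y) ↔ r.SameCycle x y := by
  have h := not_sameCycle_optionCongr r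
  rw [insertNone, sameCycle_mul_swap (h z)]
  simp only [sameCycle_optionCongr, h, and_false, or_false,
    fun x => mt SameCycle.symm (h x), false_and]

theorem sameCycle_insertNone_none (x : D) :
    (insertNone r z).SameCycle none (some x) ↔ r.SameCycle z x := by
  have h := not_sameCycle_optionCongr r
  rw [insertNone, sameCycle_mul_swap (h z)]
  simp only [sameCycle_optionCongr, h, false_or, and_false, or_false, SameCycle.refl, true_and]

/-- The second factor fixes `none`, so in the product `none` is merely threaded into an existing
cycle and creates none of its own. -/
theorem numCycles_insertNone_mul (t : Perm D) :
    numCycles (insertNone r z * (optionCongr t : Perm (Option D))) = numCycles (r * t) := by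
  have h1 : insertNone r z * (optionCongr t : Perm (Option D)) =
      swap none (some (r z)) * (optionCongr (r * t) : Perm (Option D)) := by
    rw [insertNone, mul_swap_eq_swap_mul, mul_assoc]
    congr 1
    ext1 x
    cases x <;> simp
  have h2 := numCycles_swap_mul_of_not_sameCycle (not_sameCycle_optionCongr (r * t) (r z))
  rw [h1]
  rw [numCycles_optionCongr] at h2
  omega

end

end Equiv.Perm

namespace Graph

open Equiv Equiv.Perm

/-! ### Rotation systems on other sets of darts -/

theorem RotationSystem.flip_flip {β : Type*} (E : Set β) (d : E × Bool) :
    RotationSystem.flip E (RotationSystem.flip E d) = d := by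
  rcases d with ⟨e, b⟩
  simp [RotationSystem.flip]

theorem RotationSystem.isLink_flip {α β : Type*} {G : Graph α β} (R : RotationSystem G)
    (d : E(G) × Bool) :
    G.IsLink d.1 (R.vertexAt d) (R.vertexAt (RotationSystem.flip E(G) d)) := by
  rcases d with ⟨e, _ | _⟩
  · exact R.isLink_vertexAt e
  · exact (R.isLink_vertexAt e).symm

/-- A type `D` in the role of the set of edge-ends of `G`. -/
structure DartModel {α β : Type*} (G : Graph α β) (D : Type*) where
  vert : D → α
  opp : Perm D
  toEnd : D ≃ E(G) × Bool
  toEnd_opp : ∀ d, toEnd (opp d) = RotationSystem.flip E(G) (toEnd d)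
  isLink : ∀ d, G.IsLink (toEnd d).1 (vert d) (vert (opp d))

namespace DartModel

variable {α β : Type*} {G : Graph α β} {D : Type*} (M : DartModel G D)

theorem permCongr_opp : M.toEnd.permCongr M.opp = RotationSystem.flip E(G) := by
  ext1 d
  rw [Equiv.permCongr_apply, M.toEnd_opp, Equiv.apply_symm_apply]

theorem opp_opp (d : D) : M.opp (M.opp d) = d :=
  M.toEnd.injective (by rw [M.toEnd_opp, M.toEnd_opp, RotationSystem.flip_flip])

theorem exists_rotationSystem (s : Perm D)
    (hs : ∀ d d', s.SameCycle d d' ↔ M.vert d = M.vert d') :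
    ∃ R : RotationSystem G, R.numFaces = numCycles (s * M.opp) + G.numIsolated := by
  refine ⟨⟨fun d => M.vert (M.toEnd.symm d), fun e => ?_, M.toEnd.permCongr s, fun d d' => ?_⟩, ?_⟩
  · have h := M.isLink (M.toEnd.symm (e, false))
    have h2 : M.opp (M.toEnd.symm (e, false)) = M.toEnd.symm (e, true) := by
      apply M.toEnd.injective
      rw [M.toEnd_opp, Equiv.apply_symm_apply, Equiv.apply_symm_apply]
      rfl
    rw [h2, Equiv.apply_symm_apply] at h
    exact h
  · have := sameCycle_permCongr M.toEnd s (M.toEnd.symm d) (M.toEnd.symm d')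
    rw [Equiv.apply_symm_apply, Equiv.apply_symm_apply] at this
    rw [this, hs]
  · rw [← numCycles_permCongr M.toEnd, permCongr_mul', permCongr_opp]
    rfl

/-- `R` may name the two ends of an edge differently from `M`. Exchanging the ends of exactly those
edges on which they disagree commutes with `opp`, so conjugation carries both rotation and flip over
to `D`. -/
theorem exists_perm (R : RotationSystem G) : ∃ s : Perm D,
    (∀ d d', s.SameCycle d d' ↔ M.vert d = M.vert d') ∧
      R.numFaces = numCycles (s * M.opp) + G.numIsolated := by
  classical
  have hlink : ∀ d, G.IsLink (M.toEnd d).1 (R.vertexAt (M.toEnd d))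
      (R.vertexAt (M.toEnd (M.opp d))) := fun d => by
    rw [M.toEnd_opp]; exact R.isLink_flip _
  have hstep : ∀ d, R.vertexAt (M.toEnd d) = M.vert d →
      R.vertexAt (M.toEnd (M.opp d)) = M.vert (M.opp d) := by
    intro d h
    have := hlink d
    rw [h] at this
    exact this.right_unique (M.isLink d)
  have hiff : ∀ d, R.vertexAt (M.toEnd (M.opp d)) = M.vert (M.opp d) ↔
      R.vertexAt (M.toEnd d) = M.vert d := by
    intro d
    refine ⟨fun h => ?_, hstep d⟩
    have := hstep _ h
    rwa [M.opp_opp] at this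
  -- By `hiff` the test gives the same answer at both ends of an edge, so `T` is an involution
  -- commuting with `opp`.
  let T : D → D := fun d => if R.vertexAt (M.toEnd d) = M.vert d then d else M.opp d
  have hTopp : ∀ d, T (M.opp d) = M.opp (T d) := by
    intro d
    simp only [T, hiff]
    split_ifs <;> rfl
  have hT : Function.Involutive T := by
    intro d
    by_cases h : R.vertexAt (M.toEnd d) = M.vert d
    · simp [T, h]
    · have h1 : T d = M.opp d := by simp [T, h]
      rw [h1, hTopp, h1, M.opp_opp]
  have hTv : ∀ d, R.vertexAt (M.toEnd (T d)) = M.vert d := by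
    intro d
    by_cases h : R.vertexAt (M.toEnd d) = M.vert d
    · simp [T, h]
    · have h1 : T d = M.opp d := by simp [T, h]
      rw [h1]
      rcases (hlink d).eq_and_eq_or_eq_and_eq (M.isLink d) with h2 | h2
      · exact absurd h2.1 h
      · exact h2.2
  let q : D ≃ E(G) × Bool := hT.toPerm.trans M.toEnd
  have hq : ∀ d, q d = M.toEnd (T d) := fun d => rfl
  refine ⟨q.symm.permCongr R.rot, fun d d' => ?_, ?_⟩
  · have := sameCycle_permCongr q.symm R.rot (q d) (q d')
    rw [Equiv.symm_apply_apply, Equiv.symm_apply_apply] at this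
    rw [this, R.sameCycle_rot_iff, hq, hq, hTv, hTv]
  · have h1 : M.opp = q.symm.permCongr (RotationSystem.flip E(G)) := by
      ext1 d
      apply q.injective
      rw [Equiv.permCongr_apply, Equiv.apply_symm_apply, Equiv.symm_symm, hq, hq, hTopp,
        M.toEnd_opp]
    rw [h1, ← permCongr_mul', numCycles_permCongr]
    rfl

end DartModel

/-! ### Rotations in the neighbourhood of the triple -/

section

variable {A α : Type*} (a : Perm A) (u : A → α) (t : Fin 3 → α)

/-- The end points of a new edge joining two points of a triple. -/
def pairEnd (i j : Fin 3) (b : Bool) : Fin 3 := if b then j else i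

/-- The darts at a graph with a new edge, and one further dart at the third point. -/
noncomputable def pairEquiv (A : Type*) (i j k : Fin 3) (hij : i ≠ j) (hik : i ≠ k)
    (hjk : j ≠ k) : Option (A ⊕ Bool) ≃ A ⊕ Fin 3 :=
  Equiv.ofBijective (fun x => x.elim (Sum.inr k) (Sum.map id (pairEnd i j))) <| by
    constructor
    · rintro (_ | x | _ | _) (_ | y | _ | _) h <;> simp_all [pairEnd, eq_comm]
    · rintro (x | x)
      · exact ⟨some (Sum.inl x), rfl⟩
      · have : x = i ∨ x = j ∨ x = k := by omega
        rcases this with rfl | rfl | rfl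
        · exact ⟨some (Sum.inr false), rfl⟩
        · exact ⟨some (Sum.inr true), rfl⟩
        · exact ⟨none, rfl⟩

theorem pairEquiv_permCongr (i j k : Fin 3) (hij : i ≠ j) (hik : i ≠ k) (hjk : j ≠ k) :
    (pairEquiv A i j k hij hik hjk).permCongr (optionCongr (Perm.sumCongr a Equiv.boolNot)) =
      Perm.sumCongr a (swap i j) := by
  ext1 x
  obtain ⟨y, rfl⟩ := (pairEquiv A i j k hij hik hjk).surjective x
  rw [Equiv.permCongr_apply, Equiv.symm_apply_apply]
  rcases y with _ | y | _ | _
  · exact congrArg Sum.inr (swap_apply_of_ne_of_ne hik.symm hjk.symm).symm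
  · rfl
  · exact congrArg Sum.inr (swap_apply_left i j).symm
  · exact congrArg Sum.inr (swap_apply_right i j).symm

theorem exists_third (i j : Fin 3) (hij : i ≠ j) : ∃ k, i ≠ k ∧ j ≠ k := by
  revert i j; decide

/-- The extra dart at the third point `t k` is fixed by `sumCongr a (swap i j)`, so deleting it from
the rotation keeps the cycle number, and `swap i j` becomes the flip of a new edge. -/
theorem exists_perm_pair [Finite A] (hu : ∀ i, ∃ x, u x = t i) (i j : Fin 3) (hij : i ≠ j)
    (s : Perm (A ⊕ Fin 3)) (hs : ∀ x y, s.SameCycle x y ↔ Sum.elim u t x = Sum.elim u t y) :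
    ∃ r : Perm (A ⊕ Bool), (∀ x y, r.SameCycle x y ↔
        Sum.elim u (t ∘ pairEnd i j) x = Sum.elim u (t ∘ pairEnd i j) y) ∧
      numCycles (r * Perm.sumCongr a Equiv.boolNot) = numCycles (s * Perm.sumCongr a (swap i j)) := by
  classical
  obtain ⟨k, hik, hjk⟩ := exists_third i j hij
  set p := pairEquiv A i j k hij hik hjk with hp
  have hsp := sameCycle_permCongr p (p.symm.permCongr s)
  have hps : p.permCongr (p.symm.permCongr s) = s := by ext1 x; simp [Equiv.permCongr_apply]
  rw [hps] at hsp
  -- A dart of `A` at `t k` shares the cycle of the extra dart, which is therefore not alone at its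
  -- vertex.
  have hne : p.symm.permCongr s none ≠ none := by
    intro h
    obtain ⟨x, hx⟩ := hu k
    have h1 : (p.symm.permCongr s).SameCycle none (some (Sum.inl x)) := by
      rw [← hsp, hs]
      exact hx.symm
    exact absurd (h1.eq_of_left h) (by simp)
  obtain ⟨r, z, hr⟩ := exists_eq_insertNone _ hne
  refine ⟨r, fun x y => ?_, ?_⟩
  · rw [← sameCycle_insertNone_some r z, ← hr, ← hsp, hs]
    rcases x with x | x <;> rcases y with y | y <;> rfl
  · rw [← numCycles_insertNone_mul r z, ← hr, ← numCycles_permCongr p, permCongr_mul', hps,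
      pairEquiv_permCongr]

/-- The converse construction: insert the third dart next to any dart of `A` at `t k`. -/
theorem exists_perm_triple [Finite A] (hu : ∀ i, ∃ x, u x = t i) (i j : Fin 3) (hij : i ≠ j)
    (r : Perm (A ⊕ Bool)) (hr : ∀ x y, r.SameCycle x y ↔
        Sum.elim u (t ∘ pairEnd i j) x = Sum.elim u (t ∘ pairEnd i j) y) :
    ∃ s : Perm (A ⊕ Fin 3), (∀ x y, s.SameCycle x y ↔ Sum.elim u t x = Sum.elim u t y) ∧
      numCycles (r * Perm.sumCongr a Equiv.boolNot) = numCycles (s * Perm.sumCongr a (swap i j)) := by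
  classical
  obtain ⟨k, hik, hjk⟩ := exists_third i j hij
  set p := pairEquiv A i j k hij hik hjk with hp
  obtain ⟨z, hz⟩ := hu k
  have hpn : Sum.elim u t (p none) = t k := rfl
  have hps : ∀ x, Sum.elim u t (p (some x)) = Sum.elim u (t ∘ pairEnd i j) x := by
    rintro (x | x) <;> rfl
  refine ⟨p.permCongr (insertNone r (Sum.inl z)), fun x y => ?_, ?_⟩
  · obtain ⟨x, rfl⟩ := p.surjective x
    obtain ⟨y, rfl⟩ := p.surjective y
    rw [sameCycle_permCongr]
    rcases x with _ | x <;> rcases y with _ | y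
    · simp [SameCycle.refl]
    · rw [sameCycle_insertNone_none, hr, hpn, hps, ← hz]
      rfl
    · rw [sameCycle_comm, sameCycle_insertNone_none, hr, hpn, hps, ← hz, eq_comm]
      rfl
    · rw [sameCycle_insertNone_some, hr, hps, hps]
  · rw [← numCycles_insertNone_mul r (Sum.inl z), ← numCycles_permCongr p, permCongr_mul',
      pairEquiv_permCongr]

/-! ### Rotations at the inner vertices of `H₃` -/

theorem sameCycle_innerRot (c : Fin 3 ⊕ Bool → Bool) (x y : InnerDart) :
    (innerRot c).SameCycle x y ↔ x.1 = y.1 := by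
  constructor
  · intro h
    exact sameCycle_mem_of_closed (A := fun z => x.1 = z.1) h rfl fun z (hz : x.1 = z.1) => hz
  · obtain ⟨p, k⟩ := x
    obtain ⟨q, l⟩ := y
    rintro (rfl : p = q)
    have h3 : ∀ m k l : Fin 3, m ≠ 0 → l = k ∨ l = k + m ∨ l = k + m + m := by decide
    obtain ⟨m, hm, h⟩ : ∃ m : Fin 3, m ≠ 0 ∧ ∀ k, innerRot c (p, k) = (p, k + m) := by
      cases hc : c p
      · exact ⟨2, by decide, fun k => by simp [innerRot, hc]⟩
      · exact ⟨1, by decide, fun k => by simp [innerRot, hc]⟩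
    rcases h3 m k l hm with h' | h' | h'
    · rw [h']
    · rw [h', ← h, sameCycle_apply_right]
    · rw [h', ← h, sameCycle_apply_right, ← h, sameCycle_apply_right]

/-- At each inner vertex the rotation is a permutation of `Fin 3` without fixed points, hence a
shift by 1 or by 2. -/
theorem exists_eq_innerRot (s : Perm InnerDart) (hs : ∀ x y, s.SameCycle x y ↔ x.1 = y.1) :
    ∃ c, s = innerRot c := by
  have hfin : ∀ f : Fin 3 → Fin 3, (∀ k l, f k = f l → k = l) → (∀ k, f k ≠ k) →
      (∀ k, f k = k + 1) ∨ (∀ k, f k = k + 2) := by decide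
  have h01 : ∀ k : Fin 3, k ≠ k + 1 := by decide
  have h1 : ∀ x, (s x).1 = x.1 := fun x => ((hs _ _).1 (by rw [sameCycle_apply_left]))
  have h2 : ∀ p, (∀ k, (s (p, k)).2 = k + 1) ∨ (∀ k, (s (p, k)).2 = k + 2) := by
    intro p
    refine hfin (fun k => (s (p, k)).2) (fun k l h => ?_) fun k h => ?_
    · have := s.injective (Prod.ext ((h1 (p, k)).trans (h1 (p, l)).symm) h)
      exact congrArg Prod.snd this
    · have hfix : s (p, k) = (p, k) := Prod.ext (h1 _) h
      have := (((hs (p, k) (p, k + 1)).2 rfl).eq_of_left hfix)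
      exact absurd (congrArg Prod.snd this) (h01 k)
  classical
  refine ⟨fun p => decide (∀ k, (s (p, k)).2 = k + 1), ?_⟩
  ext1 ⟨p, k⟩
  refine Prod.ext (h1 _) ?_
  by_cases h : ∀ k, (s (p, k)).2 = k + 1
  · simp [innerRot, h]
  · have h' := (h2 p).resolve_left h k
    simp [innerRot, h, h']

/-- The rotation of a graph with `H₃` attached to it. -/
def gluedRot {A : Type*} (s : Perm (A ⊕ Fin 3)) (r : Perm InnerDart) : Perm (A ⊕ H3Dart) :=
  (Equiv.sumAssoc A (Fin 3) InnerDart).permCongr (Perm.sumCongr s r)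

/-- Eliminating the inner darts adds `m` cycles, and what remains is `s * sumCongr a w` next to 15
fixed points. -/
theorem numCycles_gluedRot_mul [Finite A] (s : Perm (A ⊕ Fin 3)) (c : Fin 3 ⊕ Bool → Bool)
    (w : Perm (Fin 3)) (m : ℕ) (hw : h3Trace c = (Perm.sumCongr w 1, m)) :
    numCycles (gluedRot s (innerRot c) * Perm.sumCongr a h3Flip) + m =
      numCycles (s * Perm.sumCongr a w) + 15 := by
  have h1 : gluedRot s (innerRot c) * Perm.sumCongr a h3Flip =
      gluedRot s 1 * Perm.sumCongr a (Perm.sumCongr 1 (innerRot c) * h3Flip) := by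
    have h2 : gluedRot s (innerRot c) = gluedRot s 1 * Perm.sumCongr 1 (Perm.sumCongr 1 (innerRot c)) := by
      ext1 x
      rcases x with x | x | x <;> simp [gluedRot, Equiv.permCongr_apply]
    rw [h2, mul_assoc, sumCongr_mul, one_mul]
  have h3 := numCycles_mul_eliminate (gluedRot s 1) a innerDarts
    (by
      intro x hx
      rcases x with x | x
      · simp [innerDarts] at hx
      · simp [gluedRot, Equiv.permCongr_apply]) (Perm.sumCongr 1 (innerRot c) * h3Flip)
  have h4 : eliminate innerDarts (Perm.sumCongr 1 (innerRot c) * h3Flip) = (Perm.sumCongr w 1, m) := hw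
  rw [h4, ← h1] at h3
  rw [← h3]
  have h5 : gluedRot s 1 * Perm.sumCongr a (Perm.sumCongr w 1) =
      (Equiv.sumAssoc A (Fin 3) InnerDart).permCongr (Perm.sumCongr (s * Perm.sumCongr a w) 1) := by
    rw [gluedRot]
    have : Perm.sumCongr a (Perm.sumCongr w 1) =
        (Equiv.sumAssoc A (Fin 3) InnerDart).permCongr (Perm.sumCongr (Perm.sumCongr a w) 1) := by
      ext1 x
      rcases x with x | x | x <;> simp [Equiv.permCongr_apply]
    rw [this, ← permCongr_mul', sumCongr_mul, one_mul]
  rw [h5, numCycles_permCongr, numCycles_sumCongr, numCycles_one]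
  simp

theorem eq_innerChoice (c : Fin 3 ⊕ Bool → Bool) : c =
    innerChoice (c (.inl 0)) (c (.inl 1)) (c (.inl 2)) (c (.inr false)) (c (.inr true)) := by
  funext x
  rcases x with x | _ | _
  · fin_cases x <;> rfl
  · rfl
  · rfl

/-- Every rotation at `H₃` has at most one face more than some rotation with a single edge. -/
theorem exists_numCycles_gluedRot_le [Finite A] (s : Perm (A ⊕ Fin 3)) (c : Fin 3 ⊕ Bool → Bool) :
    ∃ i j : Fin 3, i ≠ j ∧ numCycles (gluedRot s (innerRot c) * Perm.sumCongr a h3Flip) ≤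
      numCycles (s * Perm.sumCongr a (swap i j)) + 1 := by
  classical
  have key : ∀ (w : Perm (Fin 3)) (i j : Fin 3), s * Perm.sumCongr a (w * swap i j) =
      s * Perm.sumCongr a w * swap (Sum.inr i) (Sum.inr j) := by
    intro w i j
    rw [mul_assoc, ← sumCongr_one_swap, sumCongr_mul, mul_one]
  -- For `w = 1` multiply by any transposition; for `w = swap i j * swap j k` drop the second
  -- factor. Either way at most one cycle is lost, which uses up the allowance that a transposition
  -- spends on the face inside `H₃`.
  rcases h3Trace_cases (c (.inl 0)) (c (.inl 1)) (c (.inl 2)) (c (.inr false))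
    (c (.inr true)) with h | ⟨i, j, hij, h⟩ | ⟨i, j, k, hij, hjk, h⟩ <;>
    rw [← eq_innerChoice c] at h
  · have h1 := numCycles_gluedRot_mul a s c 1 15 (by rw [h, sumCongr_one])
    refine ⟨0, 1, by decide, ?_⟩
    have h2 := key 1 0 1
    rw [one_mul] at h2
    rw [h2]
    have := numCycles_le_mul_swap (s * Perm.sumCongr a 1) (a := Sum.inr 0) (b := Sum.inr 1) (by simp)
    omega
  · have h1 := numCycles_gluedRot_mul a s c _ _ h
    exact ⟨i, j, hij, by omega⟩
  · have h1 := numCycles_gluedRot_mul a s c _ _ h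
    refine ⟨i, j, hij, ?_⟩
    rw [key] at h1
    have := numCycles_mul_swap_le (s * Perm.sumCongr a (swap i j)) (a := Sum.inr j) (b := Sum.inr k)
      (by simpa using hjk)
    omega

theorem exists_numCycles_gluedRot_eq [Finite A] (s : Perm (A ⊕ Fin 3)) (i j : Fin 3) (hij : i ≠ j) :
    ∃ c, numCycles (gluedRot s (innerRot c) * Perm.sumCongr a h3Flip) =
      numCycles (s * Perm.sumCongr a (swap i j)) + 1 := by
  obtain ⟨c₀, c₁, c₂, d₀, d₁, h⟩ := exists_h3Trace_eq_swap i j hij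
  have h1 := numCycles_gluedRot_mul a s _ _ _ h
  exact ⟨innerChoice c₀ c₁ c₂ d₀ d₁, by omega⟩

/-- The vertices of the graph with `H₃` attached at which its darts lie. -/
def gluedVert {A α : Type*} (u : A → α) (t : Fin 3 → α) : A ⊕ H3Dart → α ⊕ H3Vertex
  | .inl x => .inl (u x)
  | .inr (.inl i) => .inl (t i)
  | .inr (.inr (.inl i, _)) => .inr (.mid i)
  | .inr (.inr (.inr b, _)) => .inr (.pole b)

theorem gluedVert_sumAssoc_inl (x : A ⊕ Fin 3) :
    gluedVert u t (Equiv.sumAssoc A (Fin 3) InnerDart (Sum.inl x)) = .inl (Sum.elim u t x) := by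
  rcases x with x | x <;> rfl

theorem gluedVert_sumAssoc_inr_iff (x y : InnerDart) :
    gluedVert u t (Equiv.sumAssoc A (Fin 3) InnerDart (Sum.inr x)) =
      gluedVert u t (Equiv.sumAssoc A (Fin 3) InnerDart (Sum.inr y)) ↔ x.1 = y.1 := by
  rcases x with ⟨x | x, k⟩ <;> rcases y with ⟨y | y, l⟩ <;> simp [gluedVert]

theorem gluedVert_ne (x : A ⊕ Fin 3) (y : InnerDart) :
    gluedVert u t (Equiv.sumAssoc A (Fin 3) InnerDart (Sum.inl x)) ≠
      gluedVert u t (Equiv.sumAssoc A (Fin 3) InnerDart (Sum.inr y)) := by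
  rw [gluedVert_sumAssoc_inl]
  rcases y with ⟨y | y, l⟩ <;> simp [gluedVert]

theorem sameCycle_gluedRot (s : Perm (A ⊕ Fin 3))
    (hs : ∀ x y, s.SameCycle x y ↔ Sum.elim u t x = Sum.elim u t y) (c : Fin 3 ⊕ Bool → Bool)
    (x y : A ⊕ H3Dart) :
    (gluedRot s (innerRot c)).SameCycle x y ↔ gluedVert u t x = gluedVert u t y := by
  obtain ⟨x, rfl⟩ := (Equiv.sumAssoc A (Fin 3) InnerDart).surjective x
  obtain ⟨y, rfl⟩ := (Equiv.sumAssoc A (Fin 3) InnerDart).surjective y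
  rw [gluedRot, sameCycle_permCongr]
  rcases x with x | x <;> rcases y with y | y
  · rw [sameCycle_sumCongr_inl, hs, gluedVert_sumAssoc_inl, gluedVert_sumAssoc_inl,
      Sum.inl.injEq]
  · exact iff_of_false (not_sameCycle_sumCongr _ _ _ _) (gluedVert_ne u t x y)
  · exact iff_of_false (mt SameCycle.symm (not_sameCycle_sumCongr _ _ _ _))
      (gluedVert_ne u t y x).symm
  · rw [sameCycle_sumCongr_inr, sameCycle_innerRot, gluedVert_sumAssoc_inr_iff]

/-- A rotation preserves the set of darts at vertices of `G`, so it is a sum of two permutations. -/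
theorem exists_eq_gluedRot [Finite A] (q : Perm (A ⊕ H3Dart))
    (hq : ∀ x y, q.SameCycle x y ↔ gluedVert u t x = gluedVert u t y) :
    ∃ (s : Perm (A ⊕ Fin 3)) (c : _), (∀ x y, s.SameCycle x y ↔
      Sum.elim u t x = Sum.elim u t y) ∧ q = gluedRot s (innerRot c) := by
  set p := Equiv.sumAssoc A (Fin 3) InnerDart
  have hpq : p.permCongr (p.symm.permCongr q) = q := by ext1 x; simp [Equiv.permCongr_apply]
  have hsp := sameCycle_permCongr p (p.symm.permCongr q)
  rw [hpq] at hsp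
  have hmaps : Set.MapsTo (p.symm.permCongr q) (Set.range Sum.inl) (Set.range Sum.inl) := by
    rintro _ ⟨x, rfl⟩
    rcases h : p.symm.permCongr q (Sum.inl x) with y | y
    · exact ⟨y, rfl⟩
    · have h1 : (p.symm.permCongr q).SameCycle (Sum.inl x) (Sum.inr y) := by
        rw [← h, sameCycle_apply_right]
      rw [← hsp, hq] at h1
      exact absurd h1 (gluedVert_ne u t x y)
  obtain ⟨⟨s, r⟩, hsr⟩ := mem_sumCongrHom_range_of_perm_mapsTo_inl hmaps
  replace hsr : Perm.sumCongr s r = p.symm.permCongr q := hsr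
  rw [← hsr] at hsp
  obtain ⟨c, rfl⟩ := exists_eq_innerRot r fun x y => by
    rw [← sameCycle_sumCongr_inr s r, ← hsp, hq, gluedVert_sumAssoc_inr_iff]
  refine ⟨s, c, fun x y => ?_, ?_⟩
  · rw [← sameCycle_sumCongr_inl s (innerRot c), ← hsp, hq, gluedVert_sumAssoc_inl,
      gluedVert_sumAssoc_inl, Sum.inl.injEq]
  · rw [gluedRot, hsr, hpq]

end

end Graph

namespace Graph

open Equiv Equiv.Perm

variable {α β : Type*} {G : Graph α β}

/-! ### A graph with a new edge -/

section AddEdge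

theorem addEdge_edge_mem (x y : α) (o : Option E(G)) :
    o.map Subtype.val ∈ E(G.addEdge x y) := by
  rcases o with _ | e
  · exact ⟨x, y, rfl⟩
  · obtain ⟨a, b, h⟩ := exists_isLink_of_mem_edgeSet e.2
    exact ⟨a, b, h⟩

/-- The edges of a graph with a new edge. -/
noncomputable def addEdgeEquiv (G : Graph α β) (x y : α) :
    Option E(G) ≃ E(G.addEdge x y) :=
  Equiv.ofBijective (fun o => ⟨o.map Subtype.val, addEdge_edge_mem x y o⟩) <| by
    constructor
    · intro o o' h
      exact Option.map_injective Subtype.val_injective (congrArg Subtype.val h)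
    · rintro ⟨_ | e, h⟩
      · exact ⟨none, rfl⟩
      · obtain ⟨a, b, h'⟩ := h
        exact ⟨some ⟨e, IsLink.edge_mem (G := G) h'⟩, rfl⟩

/-- The edge-ends of a graph with a new edge. -/
noncomputable def addEdgeModel (v : E(G) × Bool → α)
    (hv : ∀ e : E(G), G.IsLink e (v (e, false)) (v (e, true))) (w : Bool → α) :
    DartModel (G.addEdge (w false) (w true)) (E(G) × Bool ⊕ Bool) where
  vert := Sum.elim v w
  opp := Perm.sumCongr (RotationSystem.flip E(G)) Equiv.boolNot
  toEnd := (Equiv.ofBijective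
    (Sum.elim (fun d => (some d.1, d.2)) (fun b => (none, b)) :
      E(G) × Bool ⊕ Bool → Option E(G) × Bool) (by
        constructor
        · rintro (⟨e, b⟩ | b) (⟨e', b'⟩ | b') h <;> simp_all
        · rintro ⟨_ | e, b⟩
          · exact ⟨Sum.inr b, rfl⟩
          · exact ⟨Sum.inl (e, b), rfl⟩)).trans
    (Equiv.prodCongr (addEdgeEquiv G _ _) (Equiv.refl Bool))
  toEnd_opp := by rintro (d | b) <;> rfl
  isLink := by
    rintro (⟨e, _ | _⟩ | _ | _)
    · exact hv e
    · exact (hv e).symm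
    · exact (rfl : s(w false, w true) = s(w false, w true))
    · exact (Sym2.eq_swap : s(w true, w false) = s(w false, w true))

theorem vertexSet_addEdge {x y : α} (hx : x ∈ V(G)) (hy : y ∈ V(G)) :
    V(G.addEdge x y) = V(G) := by
  refine Set.union_eq_left.2 ?_
  rintro z (rfl | rfl)
  · exact hx
  · exact hy

theorem numIsolated_addEdge {x y : α} (hx : ∃ e, G.Inc e x) (hy : ∃ e, G.Inc e y) :
    (G.addEdge x y).numIsolated = G.numIsolated := by
  unfold numIsolated
  congr 1
  ext z
  obtain ⟨e, he⟩ := hx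
  obtain ⟨f, hf⟩ := hy
  rw [Set.mem_ofPred_eq, Set.mem_ofPred_eq, vertexSet_addEdge he.vertex_mem hf.vertex_mem]
  refine and_congr_right fun _ => ⟨fun h e' he' => h (some e') he', ?_⟩
  rintro h (_ | e') ⟨z', h'⟩
  · have h'' : s(z, z') = s(x, y) := h'
    rw [Sym2.eq_iff] at h''
    rcases h'' with ⟨rfl, -⟩ | ⟨rfl, -⟩
    · exact h e he
    · exact h f hf
  · exact h e' ⟨z', h'⟩

theorem numComponents_addEdge {x y : α} (hx : x ∈ V(G)) (hy : y ∈ V(G))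
    (hxy : G.Reachable x y) : (G.addEdge x y).numComponents = G.numComponents := by
  have hV := vertexSet_addEdge hx hy
  refine numComponents_congr (fun z => ⟨z, hV ▸ z.2⟩) (fun z => ⟨z, hV.symm ▸ z.2⟩) ?_ ?_
    (fun z => Relation.EqvGen.refl _) (fun z => Relation.EqvGen.refl _)
  · rintro ⟨a, ha⟩ ⟨b, hb⟩ ⟨_ | e, h⟩
    · have h' : s(a, b) = s(x, y) := h
      rw [Sym2.eq_iff] at h'
      rcases h' with ⟨rfl, rfl⟩ | ⟨rfl, rfl⟩
      · exact hxy.eqvGen hx hy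
      · exact (hxy.eqvGen hx hy).symm
    · exact Relation.EqvGen.rel _ _ ⟨e, h⟩
  · rintro a b ⟨e, h⟩
    exact Relation.EqvGen.rel _ _ ⟨some e, h⟩

end AddEdge

/-! ### The scaffolded graph -/

section Scaffold

variable (G) in
theorem scaffold_edge_mem (t : Fin 3 → α) (o : E(G) ⊕ H3Edge) :
    o.map Subtype.val id ∈ E(G.scaffold t) := by
  rcases o with e | e
  · obtain ⟨a, b, h⟩ := exists_isLink_of_mem_edgeSet e.2
    exact ⟨_, _, h.map Sum.inl⟩
  · rcases e with ⟨i, b⟩ | i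
    · exact ⟨_, _, IsLink.map (G := H3) (u := .mid i) (v := .pole b) (glue t) rfl⟩
    · exact ⟨_, _, IsLink.map (G := H3) (u := .mid i) (v := .free i) (glue t) rfl⟩

/-- The edges of the scaffolded graph. -/
noncomputable def scaffoldEquiv (G : Graph α β) (t : Fin 3 → α) :
    E(G) ⊕ H3Edge ≃ E(G.scaffold t) :=
  Equiv.ofBijective (fun o => ⟨o.map Subtype.val id, scaffold_edge_mem G t o⟩) <| by
    constructor
    · intro o o' h
      exact Sum.map_injective.2 ⟨Subtype.val_injective, Function.injective_id⟩
        (congrArg Subtype.val h)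
    · rintro ⟨e | e, h⟩
      · obtain ⟨-, -, a, b, h', -, -⟩ := h
        exact ⟨Sum.inl ⟨e, h'.edge_mem⟩, rfl⟩
      · exact ⟨Sum.inr e, rfl⟩

/-- The edge-ends of `H₃`, as ends of its edges. -/
def h3DartEquiv : H3Dart ≃ H3Edge × Bool where
  toFun
    | .inl i => (.freeEdge i, true)
    | .inr (.inl i, 2) => (.freeEdge i, false)
    | .inr (.inl i, 0) => (.spoke i false, false)
    | .inr (.inl i, 1) => (.spoke i true, false)
    | .inr (.inr b, i) => (.spoke i b, true)
  invFun
    | (.freeEdge i, true) => .inl i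
    | (.freeEdge i, false) => .inr (.inl i, 2)
    | (.spoke i false, false) => .inr (.inl i, 0)
    | (.spoke i true, false) => .inr (.inl i, 1)
    | (.spoke i b, true) => .inr (.inr b, i)
  left_inv := by
    rintro (i | ⟨i | b, k⟩)
    · rfl
    · fin_cases k <;> rfl
    · cases b <;> rfl
  right_inv := by
    rintro ⟨⟨i, _ | _⟩ | i, _ | _⟩ <;> rfl

/-- The edge-ends of the scaffolded graph. -/
noncomputable def scaffoldModel (v : E(G) × Bool → α)
    (hv : ∀ e : E(G), G.IsLink e (v (e, false)) (v (e, true))) (t : Fin 3 → α) :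
    DartModel (G.scaffold t) (E(G) × Bool ⊕ H3Dart) where
  vert := gluedVert v t
  opp := Perm.sumCongr (RotationSystem.flip E(G)) h3Flip
  toEnd := ((Equiv.sumCongr (Equiv.refl _) h3DartEquiv).trans
    (Equiv.sumProdDistrib E(G) H3Edge Bool).symm).trans
    (Equiv.prodCongr (scaffoldEquiv G t) (Equiv.refl Bool))
  toEnd_opp := by
    rintro (d | i | ⟨i | _ | _, k⟩)
    · rfl
    · rfl
    · fin_cases k <;> rfl
    · rfl
    · rfl
  isLink := by
    have hs : ∀ i b, (G.scaffold t).IsLink (Sum.inr (.spoke i b)) (.inr (.mid i))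
        (.inr (.pole b)) := fun i b =>
      IsLink.map (G := H3) (u := .mid i) (v := .pole b) (glue t) rfl
    have hf : ∀ i, (G.scaffold t).IsLink (Sum.inr (.freeEdge i)) (.inr (.mid i))
        (.inl (t i)) := fun i =>
      IsLink.map (G := H3) (u := .mid i) (v := .free i) (glue t) rfl
    rintro (⟨e, _ | _⟩ | i | ⟨i | _ | _, k⟩)
    · exact (hv e).map Sum.inl
    · exact (hv e).symm.map Sum.inl
    · exact (hf i).symm
    -- At `mid i`, the indices 0 and 1 point to the poles `false` and `true`, and 2 is the free
    -- edge.
    · fin_cases k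
      · exact hs i false
      · exact hs i true
      · exact hf i
    · exact (hs k false).symm
    · exact (hs k true).symm

/-- The vertices of `H₃` other than the free nodes. -/
def innerVert : Fin 3 ⊕ Bool → H3Vertex
  | .inl i => .mid i
  | .inr b => .pole b

theorem innerVert_injective : Function.Injective innerVert := by
  rintro (i | b) (j | c) h <;> simp_all [innerVert]

theorem vertexSet_scaffold {t : Fin 3 → α} (ht : ∀ i, t i ∈ V(G)) :
    V(G.scaffold t) = Sum.inl '' V(G) ∪ Set.range (Sum.inr ∘ innerVert) := by
  change Sum.inl '' V(G) ∪ glue t '' Set.univ = _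
  ext z
  constructor
  · rintro (h | ⟨b | i | i, -, rfl⟩)
    · exact Or.inl h
    · exact Or.inr ⟨.inr b, rfl⟩
    · exact Or.inr ⟨.inl i, rfl⟩
    · exact Or.inl ⟨t i, ht i, rfl⟩
  · rintro (h | ⟨i | b, rfl⟩)
    · exact Or.inl h
    · exact Or.inr ⟨.mid i, trivial, rfl⟩
    · exact Or.inr ⟨.pole b, trivial, rfl⟩

theorem ncard_vertexSet_scaffold {t : Fin 3 → α} (ht : ∀ i, t i ∈ V(G)) (hV : V(G).Finite) :
    V(G.scaffold t).ncard = V(G).ncard + 5 := by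
  rw [vertexSet_scaffold ht, Set.ncard_union_eq (hs := hV.image _) (ht := Set.finite_range _),
    Set.ncard_image_of_injective _ Sum.inl_injective, ← Nat.card_coe_set_eq (Set.range _),
    Nat.card_range_of_injective (Sum.inr_injective.comp innerVert_injective)]
  · simp
  · rw [Set.disjoint_left]
    rintro _ ⟨x, -, rfl⟩ ⟨y, hy⟩
    simp at hy

theorem scaffold_inc_mid (t : Fin 3 → α) (i : Fin 3) :
    (G.scaffold t).Inc (.inr (.freeEdge i)) (.inr (.mid i)) :=
  ⟨_, IsLink.map (G := H3) (u := .mid i) (v := .free i) (glue t) rfl⟩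

theorem scaffold_inc_pole (t : Fin 3 → α) (b : Bool) :
    (G.scaffold t).Inc (.inr (.spoke 0 b)) (.inr (.pole b)) :=
  have h : H3.IsLink (.spoke 0 b) (.mid 0) (.pole b) := rfl
  ⟨_, (h.map (glue t)).symm⟩

theorem numIsolated_scaffold {t : Fin 3 → α} (ht : ∀ i, ∃ e, G.Inc e (t i)) :
    (G.scaffold t).numIsolated = G.numIsolated := by
  have htV : ∀ i, t i ∈ V(G) := fun i => (ht i).elim fun e he => he.vertex_mem
  unfold numIsolated
  rw [← Set.ncard_image_of_injective {v | v ∈ V(G) ∧ ∀ e, ¬ G.Inc e v}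
    (Sum.inl_injective (β := H3Vertex))]
  congr 1
  ext z
  rw [Set.mem_ofPred_eq, vertexSet_scaffold htV]
  constructor
  · rintro ⟨⟨z, hz, rfl⟩ | ⟨i | b, rfl⟩, h⟩
    · refine ⟨z, ⟨hz, ?_⟩, rfl⟩
      rintro e ⟨z', he⟩
      exact h (.inl e) ⟨_, he.map Sum.inl⟩
    · exact absurd (scaffold_inc_mid t i) (h _)
    · exact absurd (scaffold_inc_pole t b) (h _)
  · rintro ⟨z, ⟨hz, h⟩, rfl⟩
    refine ⟨Or.inl ⟨z, hz, rfl⟩, ?_⟩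
    rintro (e | e) ⟨y, a, b, he, ha, hb⟩
    · rw [Sum.inl_injective ha] at he
      exact h e ⟨b, he⟩
    -- An edge of `H₃` meets `G` only at a point of the triple, and such a point is not isolated in
    -- `G`.
    · rcases a with b' | i | i
      · simp [glue] at ha
      · simp [glue] at ha
      · obtain ⟨f, hf⟩ := ht i
        rw [Sum.inl_injective (ha : Sum.inl (t i) = _)] at hf
        exact h f hf

theorem numComponents_scaffold {t : Fin 3 → α} (ht : ∀ i, t i ∈ V(G))
    (htc : ∀ i j, G.Reachable (t i) (t j)) :
    (G.scaffold t).numComponents = G.numComponents := by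
  have hV := vertexSet_scaffold ht
  have hinl : ∀ z ∈ V(G), (.inl z : α ⊕ H3Vertex) ∈ V(G.scaffold t) := fun z hz =>
    hV ▸ Or.inl ⟨z, hz, rfl⟩
  -- The inner part of `H₃` is collapsed to `t 0`, which preserves components because the triple
  -- lies in one component of `G`.
  let f : α ⊕ H3Vertex → α := Sum.elim id (fun _ => t 0)
  have hf : ∀ z ∈ V(G.scaffold t), f z ∈ V(G) := by
    intro z hz
    rw [hV] at hz
    rcases hz with ⟨z, hz, rfl⟩ | ⟨i, rfl⟩
    · exact hz
    · exact ht 0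
  have hH : ∀ x : H3Vertex, ∀ hx : f (glue t x) ∈ V(G),
      Relation.EqvGen (fun x y : V(G) => G.Adj x y) ⟨f (glue t x), hx⟩ ⟨t 0, ht 0⟩ := by
    rintro (b | i | i) hx
    · exact Relation.EqvGen.refl _
    · exact Relation.EqvGen.refl _
    · exact (htc i 0).eqvGen _ _
  refine numComponents_congr (fun z => ⟨f z, hf z z.2⟩) (fun z => ⟨.inl z, hinl z z.2⟩) ?_ ?_ ?_ ?_
  · rintro ⟨x, hx⟩ ⟨y, hy⟩ ⟨e | e, h⟩
    · obtain ⟨a, b, h, rfl, rfl⟩ := h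
      exact Relation.EqvGen.rel _ _ ⟨e, h⟩
    · obtain ⟨a, b, h, rfl, rfl⟩ := h
      exact (hH a (hf _ hx)).trans _ _ _ ((hH b (hf _ hy)).symm)
  · rintro x y ⟨e, he⟩
    exact Relation.EqvGen.rel _ _ ⟨.inl e, he.map Sum.inl⟩
  · have hmid : ∀ i (hi : (.inr (.mid i) : α ⊕ H3Vertex) ∈ V(G.scaffold t)),
        Relation.EqvGen (fun x y : V(G.scaffold t) => (G.scaffold t).Adj x y)
          ⟨.inl (t 0), hinl _ (ht 0)⟩ ⟨.inr (.mid i), hi⟩ := by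
      intro i hi
      have h1 : Relation.EqvGen (fun x y : V(G.scaffold t) => (G.scaffold t).Adj x y)
          ⟨.inl (t 0), hinl _ (ht 0)⟩ ⟨.inl (t i), hinl _ (ht i)⟩ := by
        have h2 : (G.scaffold t).Reachable (.inl (t 0)) (.inl (t i)) :=
          Relation.ReflTransGen.lift (p := (G.scaffold t).Adj) Sum.inl
            (fun x y ⟨e, he⟩ => ⟨.inl e, he.map Sum.inl⟩) _ _ (htc 0 i)
        exact h2.eqvGen _ _
      refine h1.trans _ _ _
        (Relation.EqvGen.symm _ _ (Relation.EqvGen.rel _ _ ⟨.inr (.freeEdge i), ?_⟩))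
      exact IsLink.map (G := H3) (u := .mid i) (v := .free i) (glue t) rfl
    rintro ⟨z, hz⟩
    have hz' := hz
    rw [hV] at hz'
    rcases hz' with ⟨z, -, rfl⟩ | ⟨i | b, rfl⟩
    · exact Relation.EqvGen.refl _
    · exact hmid i hz
    · refine (hmid 0 (scaffold_inc_mid t 0).vertex_mem).trans _ _ _ (Relation.EqvGen.rel _ _ ⟨.inr (.spoke 0 b), ?_⟩)
      exact IsLink.map (G := H3) (u := .mid 0) (v := .pole b) (glue t) rfl
  · intro y
    exact Relation.EqvGen.refl _

end Scaffold

/-! ### The genus of the scaffolded graph -/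

theorem exists_inc_of_valence_ne_zero {v : α} (h : G.valence v ≠ 0) : ∃ e, G.Inc e v := by
  by_contra hcon
  have h1 : G.incidenceSet v = ∅ := Set.eq_empty_of_forall_notMem fun e he => hcon ⟨e, he⟩
  have h2 : G.loopSet v = ∅ := Set.subset_eq_empty (G.loopSet_subset_incidenceSet v) h1
  exact h (by simp [valence, h1, h2])

theorem DartModel.finite_edgeSet {D : Type*} [Finite D] (M : DartModel G D) : E(G).Finite := by
  have : Finite (E(G) × Bool) := Finite.of_equiv D M.toEnd
  have : Finite E(G) := Finite.of_surjective (Prod.fst : E(G) × Bool → E(G)) Prod.fst_surjective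
  exact Set.toFinite _

theorem DartModel.card_eq {D : Type*} (M : DartModel G D) : Nat.card D = E(G).ncard * 2 := by
  rw [Nat.card_congr M.toEnd, Nat.card_prod, Nat.card_coe_set_eq]
  simp

end Graph

open Equiv Equiv.Perm Graph in
theorem mainTheorem7 {α β : Type*} (G : Graph α β)
    (hV : V(G).Finite) (hE : E(G).Finite)
    (t : Fin 3 → α) (ht : Function.Injective t) (htV : ∀ i, t i ∈ V(G))
    (ht2 : ∀ i, G.valence (t i) = 2)
    (htc : ∀ i j, G.Reachable (t i) (t j)) :
    (G.scaffold t).genus = G.tripleGenus t + 1 := by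
  have hti : ∀ i, ∃ e, G.Inc e (t i) := fun i =>
    exists_inc_of_valence_ne_zero (by rw [ht2 i]; decide)
  have := hE.to_subtype
  obtain ⟨v, hv⟩ := G.exists_vertexAt
  have hu : ∀ i, ∃ d, v d = t i := by
    intro i
    obtain ⟨e, he⟩ := hti i
    rcases he.eq_or_eq_of_isLink (hv ⟨e, he.edge_mem⟩) with h | h
    · exact ⟨_, h.symm⟩
    · exact ⟨_, h.symm⟩
  let M := scaffoldModel v hv t
  let N : ∀ i j, DartModel (G.addEdge (t i) (t j)) (E(G) × Bool ⊕ Bool) := fun i j =>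
    addEdgeModel v hv (t ∘ pairEnd i j)
  have hVN : ∀ i j, V(G.addEdge (t i) (t j)) = V(G) := fun i j =>
    vertexSet_addEdge (htV i) (htV j)
  have hVM : V(G.scaffold t).ncard = V(G).ncard + 5 := ncard_vertexSet_scaffold htV hV
  -- An infinite set has `ncard` zero, so a positive value gives finiteness.
  have hVM' : V(G.scaffold t).Finite := Set.finite_of_ncard_pos (by omega)
  have hEN : ∀ i j, E(G.addEdge (t i) (t j)).ncard = E(G).ncard + 1 := by
    intro i j
    have := (N i j).card_eq
    simp only [Nat.card_sum, Nat.card_prod, Nat.card_coe_set_eq, Nat.card_eq_fintype_card,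
      Fintype.card_bool] at this
    omega
  have hEM : E(G.scaffold t).ncard = E(G).ncard + 9 := by
    have := M.card_eq
    have h18 : Nat.card H3Dart = 18 := by rw [Nat.card_eq_fintype_card]; rfl
    rw [Nat.card_sum, h18, Nat.card_prod, Nat.card_coe_set_eq, Nat.card_eq_fintype_card,
      Fintype.card_bool] at this
    omega
  have hIM := numIsolated_scaffold hti
  have hIN : ∀ i j, (G.addEdge (t i) (t j)).numIsolated = G.numIsolated := fun i j =>
    numIsolated_addEdge (hti i) (hti j)
  have hCM := numComponents_scaffold htV htc
  have hCN : ∀ i j, (G.addEdge (t i) (t j)).numComponents = G.numComponents := fun i j =>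
    numComponents_addEdge (htV i) (htV j) (htc i j)
  apply le_antisymm
  · have hne : (genus '' G.tripleExtensions t).Nonempty :=
      ⟨_, _, ⟨0, 1, by decide, rfl⟩, rfl⟩
    obtain ⟨X, ⟨i, j, hij, rfl⟩, hX⟩ := Nat.sInf_mem hne
    obtain ⟨R, hR⟩ := exists_hasGenus_genus (G := G.addEdge (t i) (t j))
      (by rw [hVN]; exact hV) (N i j).finite_edgeSet
    obtain ⟨r, hr, hRr⟩ := (N i j).exists_perm R
    obtain ⟨s, hs, hrs⟩ := exists_perm_triple (RotationSystem.flip E(G)) v t hu i j hij r hr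
    obtain ⟨c, hc⟩ := exists_numCycles_gluedRot_eq (RotationSystem.flip E(G)) s i j hij
    obtain ⟨R', hR'⟩ := M.exists_rotationSystem _ (sameCycle_gluedRot v t s hs c)
    refine genus_le R' ?_
    have hfaces : R'.numFaces = R.numFaces + 1 := by
      rw [hR', hRr, hIM, hIN]
      change numCycles (gluedRot s (innerRot c) * Perm.sumCongr _ h3Flip) + _ =
        numCycles (r * Perm.sumCongr _ Equiv.boolNot) + _ + 1
      rw [hc, hrs]
      omega
    have htr : G.tripleGenus t = (G.addEdge (t i) (t j)).genus := hX.symm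
    unfold RotationSystem.HasGenus at hR ⊢
    rw [hVN, hEN, hCN] at hR
    rw [hVM, hEM, hCM, hfaces, htr]
    push_cast at hR ⊢
    -- The Euler characteristics differ by 5 - 9 + 1 + 1 = -2: five vertices, nine edges against the
    -- one new edge, and one more face.
    linarith
  · obtain ⟨R, hR⟩ := exists_hasGenus_genus hVM' M.finite_edgeSet
    obtain ⟨q, hq, hRq⟩ := M.exists_perm R
    obtain ⟨s, c, hs, rfl⟩ := exists_eq_gluedRot v t q hq
    obtain ⟨i, j, hij, hle⟩ := exists_numCycles_gluedRot_le (RotationSystem.flip E(G)) s c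
    obtain ⟨r, hr, hrs⟩ := exists_perm_pair (RotationSystem.flip E(G)) v t hu i j hij s hs
    obtain ⟨R', hR'⟩ := (N i j).exists_rotationSystem r hr
    -- `R'` need not be optimal; its genus, a natural number by the Euler equation, bounds
    -- `tripleGenus` from above.
    obtain ⟨g, hg⟩ := R'.exists_hasGenus (by rw [hVN]; exact hV) (N i j).finite_edgeSet
    have h1 : G.tripleGenus t ≤ g :=
      (Nat.sInf_le (Set.mem_image_of_mem genus
        (show G.addEdge (t i) (t j) ∈ G.tripleExtensions t from ⟨i, j, hij, rfl⟩))).trans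
        (genus_le R' hg)
    have hfaces : R.numFaces ≤ R'.numFaces + 1 := by
      rw [hR', hRq, hIM, hIN]
      change numCycles (gluedRot s (innerRot c) * Perm.sumCongr _ h3Flip) + _ ≤
        numCycles (r * Perm.sumCongr _ Equiv.boolNot) + _ + 1
      rw [hrs]
      omega
    unfold RotationSystem.HasGenus at hR hg
    rw [hVN, hEN, hCN] at hg
    rw [hVM, hEM, hCM] at hR
    push_cast at hR hg
    omega
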